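/- We work over $\mathbb{C}$. Let $\mathcal{O}(a,b)=\mathcal{O}_{\mathbb{P}^1}(a)\boxtimes\mathcal{O}_{\mathbb{P}^2}(b)$ on $\mathbb{P}^1\times\mathbb{P}^2$. A rational curve of bidegree $(5,2)$ in $\mathbb{P}^1\times\mathbb{P}^2$ is the image $C$ of a morphism $\mathbb{P}^1\to\mathbb{P}^1\times\mathbb{P}^2$, $t\mapsto((f_0(t):f_1(t)),(g_0(t):g_1(t):g_2(t)))$, where $f_0,f_1$ are binary forms of degree $5$ without common zeros and $g_0,g_1,g_2$ are binary forms of degree $2$ without common zeros (such a morphism is automatically birational onto its image, since $5$ and $2$ are coprime); $C$ carries its reduced structure and $\mathcal{I}_C$ is its ideal sheaf. The tuples $(f,g)$ form a nonempty Zariski open subset $\mathcal{R}$ of the affine space of all tuples of forms. Let $\mathcal{M}$ be the affine space of all $3\times 2$ matrices of bihomogeneous forms defining morphisms $$\mathcal{O}(-1,-4)^{\oplus 2}\longrightarrow\mathcal{O}(0,-2)\oplus\mathcal{O}(-1,-3)^{\oplus 2},$$ that is, the entries of the first row have bidegree $(1,2)$ and the entries of the other two rows have bidegree $(0,1)$.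 (1) There is a nonempty Zariski open subset of $\mathcal{R}$ such that for every curve $C$ in it there are a matrix $M\in\mathcal{M}$ and a short exact sequence of sheaves of $\mathcal{O}$-modules $$0\longrightarrow\mathcal{O}(-1,-4)^{\oplus 2}\xrightarrow{\;M\;}\mathcal{O}(0,-2)\oplus\mathcal{O}(-1,-3)^{\oplus 2}\longrightarrow\mathcal{I}_C\longrightarrow 0.\qquad(*)$$ (2) Conversely, a general matrix presents the ideal sheaf of a general curve: for every nonempty Zariski open subset $U\subseteq\mathcal{R}$ there is a nonempty Zariski open subset $W\subseteq\mathcal{M}$ such that for every $M\in W$ there are a curve $C$ in $U$ and a short exact sequence $(*)$ whose first morphism is given by $M$. -/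

import Mathlib

open CategoryTheory TopologicalSpace Opposite

open scoped Topology

noncomputable section

namespace ProjLinePlane

/-! ### The variety `ℙ¹ × ℙ²` over `ℂ` and its Cox ring -/

/-- The closed points of `ℙ¹ × ℙ²` over `ℂ`. -/
@[ext]
structure Pt where
  /-- the component in the projective line -/
  fst : Projectivization ℂ (Fin 2 → ℂ)
  /-- the component in the projective plane -/
  snd : Projectivization ℂ (Fin 3 → ℂ)

/-- Homogeneous coordinates of points of `ℙ¹ × ℙ²`: a nonzero vector of `ℂ²` and a nonzero
vector of `ℂ³`. -/
abbrev Coord : Type := {v : Fin 2 → ℂ // v ≠ 0} × {w : Fin 3 → ℂ // w ≠ 0}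

/-- The point with the given homogeneous coordinates. -/
def proj (y : Coord) : Pt :=
  ⟨Projectivization.mk ℂ y.1.1 y.1.2, Projectivization.mk ℂ y.2.1 y.2.2⟩

/-- The Cox ring `ℂ[s₀, s₁, x₀, x₁, x₂]` of `ℙ¹ × ℙ²`. -/
abbrev Cox : Type := MvPolynomial (Fin 2 ⊕ Fin 3) ℂ

/-- The bigrading: the `sᵢ` have bidegree `(1, 0)`, the `xⱼ` have bidegree `(0, 1)`. -/
def bideg : Fin 2 ⊕ Fin 3 → ℤ × ℤ := Sum.elim (fun _ => (1, 0)) (fun _ => (0, 1))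

/-- The space of bihomogeneous forms of bidegree `d` (it is zero if an entry of `d` is negative). -/
abbrev Forms (d : ℤ × ℤ) : Submodule ℂ Cox :=
  MvPolynomial.weightedHomogeneousSubmodule ℂ bideg d

/-- The value of a polynomial at homogeneous coordinates. -/
def val (F : Cox) (y : Coord) : ℂ := MvPolynomial.eval (Sum.elim y.1.1 y.2.1) F

/-- The Zariski topology of `ℙ¹ × ℙ²`: a basis of open sets is given by the loci where a
bihomogeneous form does not vanish. -/
instance : TopologicalSpace Pt :=
  generateFrom {U | ∃ (d : ℤ × ℤ) (G : Forms d), U = {p | ∀ y, proj y = p → val G y ≠ 0}}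

/-- `ℙ¹ × ℙ²` with its Zariski topology. -/
abbrev X : TopCat.{0} := TopCat.of Pt

/-- The homogeneous coordinates of the points of an open set. -/
abbrev Over (U : Opens X) : Type := {y : Coord // proj y ∈ U}

/-- Restriction of functions. -/
def res {W : Type} {U V : Opens X} (h : V ≤ U) (σ : Over U → W) : Over V → W :=
  fun y => σ ⟨y.1, h y.2⟩

/-! ### The structure sheaf, the sheaves `𝒪(a, b)` and ideal sheaves -/

/-- A function of the homogeneous coordinates of the points of `U` is a section of `𝒪(d)` over `U`
if, locally on `U`, it is a fraction `F / G` of bihomogeneous forms whose bidegrees differ by `d`,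
with `G` nowhere zero. -/
def IsSection (d : ℤ × ℤ) {U : Opens X} (σ : Over U → ℂ) : Prop :=
  ∀ p ∈ U, ∃ (V : Opens X) (h : V ≤ U) (e : ℤ × ℤ) (F : Forms (e + d)) (G : Forms e), p ∈ V ∧
    ∀ y : Over V, val G y.1 ≠ 0 ∧ res h σ y = val F y.1 / val G y.1

section basic

variable {d e : ℤ × ℤ} {U V : Opens X}

lemma val_add (F G : Cox) (y : Coord) : val (F + G) y = val F y + val G y := by simp [val]

lemma val_mul (F G : Cox) (y : Coord) : val (F * G) y = val F y * val G y := by simp [val]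

lemma val_neg (F : Cox) (y : Coord) : val (-F) y = -val F y := by simp [val]

lemma mul_mem {F G : Cox} (hF : F ∈ Forms d) (hG : G ∈ Forms e) : F * G ∈ Forms (d + e) :=
  MvPolynomial.IsWeightedHomogeneous.mul hF hG

lemma IsSection.of_form (F : Forms d) : IsSection d (U := U) (fun y => val F y.1) := fun p hp =>
  ⟨U, le_rfl, 0, ⟨F, by simp⟩,
    ⟨1, MvPolynomial.isWeightedHomogeneous_one ℂ bideg⟩, hp,
    fun y => ⟨by simp [val], by simp [val, res]⟩⟩

lemma IsSection.zero : IsSection d (0 : Over U → ℂ) := fun p hp =>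
  ⟨U, le_rfl, 0, ⟨0, zero_mem _⟩, ⟨1, MvPolynomial.isWeightedHomogeneous_one ℂ bideg⟩, hp,
    fun y => ⟨by simp [val], by simp [val, res]⟩⟩

lemma IsSection.one : IsSection 0 (1 : Over U → ℂ) := fun p hp =>
  ⟨U, le_rfl, 0, ⟨1, MvPolynomial.isWeightedHomogeneous_one ℂ bideg⟩,
    ⟨1, MvPolynomial.isWeightedHomogeneous_one ℂ bideg⟩, hp,
    fun y => ⟨by simp [val], by simp [val, res]⟩⟩

lemma IsSection.neg {σ : Over U → ℂ} (hσ : IsSection d σ) : IsSection d (-σ) := fun p hp => by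
  obtain ⟨V, h, e, F, G, hpV, H⟩ := hσ p hp
  refine ⟨V, h, e, -F, G, hpV, fun y => ⟨(H y).1, ?_⟩⟩
  have := (H y).2
  simp only [res] at this
  simp [res, this, val_neg, neg_div]

lemma IsSection.add {σ τ : Over U → ℂ} (hσ : IsSection d σ) (hτ : IsSection d τ) :
    IsSection d (σ + τ) := fun p hp => by
  obtain ⟨V, h, e, F, G, hpV, H⟩ := hσ p hp
  obtain ⟨V', h', e', F', G', hpV', H'⟩ := hτ p hp
  refine ⟨V ⊓ V', inf_le_left.trans h, e + e', ⟨F * G' + F' * G, add_mem ?_ ?_⟩,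
    ⟨G * G', mul_mem G.2 G'.2⟩, ⟨hpV, hpV'⟩, fun y => ?_⟩
  · have := mul_mem F.2 G'.2
    rwa [add_right_comm] at this
  · have := mul_mem F'.2 G.2
    rwa [show e' + d + e = e + e' + d by abel] at this
  · obtain ⟨h1, h2⟩ := H ⟨y.1, y.2.1⟩
    obtain ⟨h3, h4⟩ := H' ⟨y.1, y.2.2⟩
    simp only [res] at h1 h2 h3 h4 ⊢
    refine ⟨by rw [val_mul]; exact mul_ne_zero h1 h3, ?_⟩
    rw [Pi.add_apply, h2, h4, val_mul, val_add, val_mul, val_mul, div_add_div _ _ h1 h3]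
    ring

lemma IsSection.mul {σ τ : Over U → ℂ} (hσ : IsSection d σ) (hτ : IsSection e τ) :
    IsSection (d + e) (σ * τ) := fun p hp => by
  obtain ⟨V, h, a, F, G, hpV, H⟩ := hσ p hp
  obtain ⟨V', h', a', F', G', hpV', H'⟩ := hτ p hp
  refine ⟨V ⊓ V', inf_le_left.trans h, a + a', ⟨F * F', ?_⟩,
    ⟨G * G', mul_mem G.2 G'.2⟩, ⟨hpV, hpV'⟩, fun y => ?_⟩
  · have := mul_mem F.2 F'.2
    rwa [show a + d + (a' + e) = a + a' + (d + e) by abel] at this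
  · obtain ⟨h1, h2⟩ := H ⟨y.1, y.2.1⟩
    obtain ⟨h3, h4⟩ := H' ⟨y.1, y.2.2⟩
    simp only [res] at h1 h2 h3 h4 ⊢
    refine ⟨by rw [val_mul]; exact mul_ne_zero h1 h3, ?_⟩
    rw [Pi.mul_apply, h2, h4, val_mul, val_mul, div_mul_div_comm]

lemma IsSection.res {σ : Over U → ℂ} (hσ : IsSection d σ) (h : V ≤ U) :
    IsSection d (res h σ) := fun p hp => by
  obtain ⟨V', h', e, F, G, hpV, H⟩ := hσ p (h hp)
  exact ⟨V' ⊓ V, inf_le_right, e, F, G, ⟨hpV, hp⟩, fun y => H ⟨y.1, y.2.1⟩⟩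

lemma IsSection.of_local {σ : Over U → ℂ}
    (hσ : ∀ p ∈ U, ∃ (V : Opens X) (h : V ≤ U), p ∈ V ∧ IsSection d (ProjLinePlane.res h σ)) :
    IsSection d σ := fun p hp => by
  obtain ⟨V, h, hpV, H⟩ := hσ p hp
  obtain ⟨V', h', e, F, G, hpV', H'⟩ := H p hpV
  exact ⟨V', h'.trans h, e, F, G, hpV', H'⟩

end basic

/-- The ring `𝒪(U)` of regular functions on the open set `U`. -/
def regular (U : Opens X) : Subring (Over U → ℂ) where
  carrier := {σ | IsSection 0 σ}
  zero_mem' := IsSection.zero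
  one_mem' := IsSection.one
  add_mem' := IsSection.add
  neg_mem' := IsSection.neg
  mul_mem' h h' := by simpa using IsSection.mul h h'

/-- A sheaf of `𝒪`-modules that consists of functions of the homogeneous coordinates with values
in the vector space `W`: modules of functions which are stable under restriction, such that
membership is a local condition. -/
structure FunctionModule (W : Type) [AddCommGroup W] [Module ℂ W] where
  /-- the sections over an open set -/
  sec (U : Opens X) : Submodule (regular U) (Over U → W)
  res_mem {U V : Opens X} (h : V ≤ U) (σ : Over U → W) : σ ∈ sec U → res h σ ∈ sec V
  of_local {U : Opens X} (σ : Over U → W) :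
    (∀ p ∈ U, ∃ (V : Opens X) (h : V ≤ U), p ∈ V ∧ res h σ ∈ sec V) → σ ∈ sec U

/-- The structure sheaf as a presheaf of rings. -/
def structurePresheaf : (Opens X)ᵒᵖ ⥤ RingCat.{0} where
  obj U := RingCat.of (regular U.unop)
  map {U V} i := RingCat.ofHom
    { toFun := fun σ => ⟨res i.unop.le σ.1, σ.2.res i.unop.le⟩
      map_zero' := rfl
      map_one' := rfl
      map_add' := fun _ _ => rfl
      map_mul' := fun _ _ => rfl }

/-- Functions that are given on the members of an open covering and agree on overlaps glue. -/
lemma exists_glue {W : Type} {ι : Type} (U : ι → Opens X) (sf : ∀ i, Over (U i) → W)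
    (hsf : ∀ i j (y : Coord) (hi : proj y ∈ U i) (hj : proj y ∈ U j),
      sf i ⟨y, hi⟩ = sf j ⟨y, hj⟩) :
    ∃ σ : Over (iSup U) → W, ∀ i, res (le_iSup U i) σ = sf i := by
  have hm : ∀ y : Over (iSup U), ∃ i, proj y.1 ∈ U i := fun y => by simpa using y.2
  choose c hc using hm
  exact ⟨fun y => sf (c y) ⟨y.1, hc y⟩, fun i => funext fun y => hsf _ _ _ _ _⟩

lemma isSheaf_structurePresheaf :
    Presheaf.IsSheaf (Opens.grothendieckTopology X) structurePresheaf := by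
  refine (TopCat.Presheaf.isSheaf_iff_isSheaf_comp (forget RingCat) structurePresheaf).2 ?_
  refine TopCat.Presheaf.isSheaf_of_isSheafUniqueGluing_types _ ?_
  intro ι U sf hsf
  obtain ⟨σ, hσ⟩ := exists_glue U (fun i => (sf i : regular (U i)).1) (fun i j y hi hj =>
    congrFun (congrArg Subtype.val (hsf i j)) ⟨y, hi, hj⟩)
  refine ⟨(⟨σ, ?_⟩ : regular (iSup U)), fun i => Subtype.ext (hσ i), fun τ hτ => ?_⟩
  · refine IsSection.of_local fun p hp => ?_
    obtain ⟨i, hi⟩ := Opens.mem_iSup.1 hp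
    exact ⟨U i, le_iSup U i, hi, by rw [hσ]; exact (sf i : regular (U i)).2⟩
  · refine Subtype.ext (funext fun y => ?_)
    obtain ⟨i, hi⟩ := Opens.mem_iSup.1 y.2
    exact (congrFun (congrArg Subtype.val (hτ i)) ⟨y.1, hi⟩).trans
      (congrFun (hσ i) ⟨y.1, hi⟩).symm

/-- The structure sheaf `𝒪` of `ℙ¹ × ℙ²`. -/
def structureSheaf : Sheaf (Opens.grothendieckTopology X) RingCat.{0} :=
  ⟨structurePresheaf, isSheaf_structurePresheaf⟩

namespace FunctionModule

variable {W : Type} [AddCommGroup W] [Module ℂ W] (M : FunctionModule W)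

/-- The presheaf of abelian groups of a sheaf of functions. -/
def toAbPresheaf : (Opens X)ᵒᵖ ⥤ AddCommGrpCat.{0} where
  obj U := AddCommGrpCat.of (M.sec U.unop)
  map {U V} i := AddCommGrpCat.ofHom
    { toFun := fun σ => ⟨res i.unop.le σ.1, M.res_mem i.unop.le σ.1 σ.2⟩
      map_zero' := rfl
      map_add' := fun _ _ => rfl }

instance (U : (Opens X)ᵒᵖ) : Module (structureSheaf.obj.obj U) (M.toAbPresheaf.obj U) :=
  inferInstanceAs (Module (regular U.unop) (M.sec U.unop))

/-- The presheaf of `𝒪`-modules of a sheaf of functions. -/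
def toPresheaf : PresheafOfModules.{0} structureSheaf.obj :=
  PresheafOfModules.ofPresheaf M.toAbPresheaf (by intros; rfl)

lemma isSheaf_toAbPresheaf :
    Presheaf.IsSheaf (Opens.grothendieckTopology X) M.toAbPresheaf := by
  refine (TopCat.Presheaf.isSheaf_iff_isSheaf_comp (forget AddCommGrpCat)
    M.toAbPresheaf).2 ?_
  refine TopCat.Presheaf.isSheaf_of_isSheafUniqueGluing_types _ ?_
  intro ι U sf hsf
  obtain ⟨σ, hσ⟩ := exists_glue U (fun i => (sf i : M.sec (U i)).1) (fun i j y hi hj =>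
    congrFun (congrArg Subtype.val (hsf i j)) ⟨y, hi, hj⟩)
  refine ⟨(⟨σ, ?_⟩ : M.sec (iSup U)), fun i => Subtype.ext (hσ i), fun τ hτ => ?_⟩
  · refine M.of_local _ fun p hp => ?_
    obtain ⟨i, hi⟩ := Opens.mem_iSup.1 hp
    exact ⟨U i, le_iSup U i, hi, by rw [hσ]; exact (sf i : M.sec (U i)).2⟩
  · refine Subtype.ext (funext fun y => ?_)
    obtain ⟨i, hi⟩ := Opens.mem_iSup.1 y.2
    exact (congrFun (congrArg Subtype.val (hτ i)) ⟨y.1, hi⟩).trans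
      (congrFun (hσ i) ⟨y.1, hi⟩).symm

/-- The sheaf of `𝒪`-modules of a sheaf of functions. -/
def toSheaf : SheafOfModules.{0} structureSheaf := ⟨M.toPresheaf, M.isSheaf_toAbPresheaf⟩

end FunctionModule

/-- The sections of the direct sum of the `𝒪(d i)`: tuples whose `i`-th component is a section
of `𝒪(d i)`. -/
def twistSumFunctions {ι : Type} (d : ι → ℤ × ℤ) : FunctionModule (ι → ℂ) where
  sec U :=
    { carrier := {σ | ∀ i, IsSection (d i) (fun y => σ y i)}
      zero_mem' := fun _ => IsSection.zero
      add_mem' := fun h h' i => (h i).add (h' i)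
      smul_mem' := fun r σ h i => by have := IsSection.mul r.2 (h i); rwa [zero_add] at this }
  res_mem h σ hσ i := (hσ i).res h
  of_local σ hσ i := IsSection.of_local fun p hp => by
    obtain ⟨V, h, hpV, H⟩ := hσ p hp
    exact ⟨V, h, hpV, H i⟩

/-- The locally free sheaf `⨁ i, 𝒪(d i)` on `ℙ¹ × ℙ²`. -/
def twistSum {ι : Type} (d : ι → ℤ × ℤ) : SheafOfModules.{0} structureSheaf :=
  (twistSumFunctions d).toSheaf

/-- The regular functions that vanish at all points of `C`. -/
def idealFunctions (C : Set Pt) : FunctionModule ℂ where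
  sec U :=
    { carrier := {σ | IsSection 0 σ ∧ ∀ y : Over U, proj y.1 ∈ C → σ y = 0}
      zero_mem' := ⟨IsSection.zero, fun _ _ => rfl⟩
      add_mem' := fun h h' => ⟨h.1.add h'.1, fun y hy => by
        rw [Pi.add_apply, h.2 y hy, h'.2 y hy, add_zero]⟩
      smul_mem' := fun r σ h => ⟨by have := IsSection.mul r.2 h.1; rwa [add_zero] at this,
        fun y hy => show r.1 y * σ y = 0 by rw [h.2 y hy, mul_zero]⟩ }
  res_mem h σ hσ := ⟨hσ.1.res h, fun y hy => hσ.2 ⟨y.1, h y.2⟩ hy⟩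
  of_local σ hσ := ⟨IsSection.of_local fun p hp => by
      obtain ⟨V, h, hpV, H⟩ := hσ p hp
      exact ⟨V, h, hpV, H.1⟩,
    fun y hy => by
      obtain ⟨V, h, hpV, H⟩ := hσ _ y.2
      exact H.2 ⟨y.1, hpV⟩ hy⟩

/-- The ideal sheaf of `C` (with its reduced structure) in `ℙ¹ × ℙ²`. -/
def idealSheaf (C : Set Pt) : SheafOfModules.{0} structureSheaf := (idealFunctions C).toSheaf

/-! ### Matrices of bihomogeneous forms -/

section matrix

variable {m n : ℕ}

/-- Matrices of bihomogeneous forms that define morphisms `⨁ j, 𝒪(e j) ⟶ ⨁ i, 𝒪(d i)`: the entry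
in row `i` and column `j` has bidegree `d i - e j`. -/
abbrev FormMatrix (e : Fin n → ℤ × ℤ) (d : Fin m → ℤ × ℤ) : Type :=
  (i : Fin m) → (j : Fin n) → Forms (d i - e j)

variable {e : Fin n → ℤ × ℤ} {d : Fin m → ℤ × ℤ}

lemma isSection_mulVec (M : FormMatrix e d) {U : Opens X} (σ : Over U → Fin n → ℂ)
    (hσ : σ ∈ (twistSumFunctions e).sec U) (i : Fin m) :
    IsSection (d i) (fun y : Over U => ∑ j, val (M i j) y.1 * σ y j) := by
  have key : ∀ s : Finset (Fin n),
      IsSection (d i) (fun y : Over U => ∑ j ∈ s, val (M i j) y.1 * σ y j) := by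
    intro s
    induction s using Finset.induction_on with
    | empty => simpa using! IsSection.zero
    | insert j s hj ih =>
      simp only [Finset.sum_insert hj]
      refine IsSection.add (σ := fun y : Over U => val (M i j) y.1 * σ y j) ?_ ih
      have := IsSection.mul (IsSection.of_form (U := U) (M i j)) (hσ j)
      rwa [sub_add_cancel] at this
  exact key Finset.univ

/-- Multiplication of column vectors of sections over `U` by a matrix of forms. -/
def mulVec (M : FormMatrix e d) (U : Opens X) :
    (twistSumFunctions e).sec U →ₗ[regular U] (twistSumFunctions d).sec U where
  toFun σ := ⟨fun y i => ∑ j, val (M i j) y.1 * σ.1 y j, isSection_mulVec M σ.1 σ.2⟩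
  map_add' σ τ := Subtype.ext <| by
    funext y i
    simp [mul_add, Finset.sum_add_distrib]
  map_smul' r σ := Subtype.ext <| by
    funext y i
    change ∑ j, val (M i j) y.1 * (r.1 y * σ.1 y j) = r.1 y * ∑ j, val (M i j) y.1 * σ.1 y j
    rw [Finset.mul_sum]
    exact Finset.sum_congr rfl fun j _ => by ring

/-- The morphism of sheaves `⨁ j, 𝒪(e j) ⟶ ⨁ i, 𝒪(d i)` given by a matrix of forms. -/
def matrixHom (M : FormMatrix e d) : twistSum e ⟶ twistSum d where
  val := PresheafOfModules.homMk
    { app := fun U => AddCommGrpCat.ofHom (mulVec M U.unop).toAddMonoidHom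
      naturality := fun _ _ _ => rfl }
    (fun U r σ => (mulVec M U.unop).map_smul r σ)

/-- The matrix `M` presents the ideal sheaf of `C`, by a short exact sequence of sheaves
`0 ⟶ ⨁ j, 𝒪(e j) ⟶ ⨁ i, 𝒪(d i) ⟶ ℐ_C ⟶ 0` whose first morphism is given by `M`. -/
def Resolves (M : FormMatrix e d) (C : Set Pt) : Prop :=
  ∃ (ψ : twistSum d ⟶ idealSheaf C) (w : matrixHom M ≫ ψ = 0),
    (ShortComplex.mk (matrixHom M) ψ w).ShortExact

end matrix

/-! ### The Zariski topology on parameter spaces and rational curves -/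

/-- The ring of polynomial functions on a (finite-dimensional) complex vector space: the algebra
of functions generated by the linear forms. -/
def polyFunctions (V : Type) [AddCommGroup V] [Module ℂ V] : Subalgebra ℂ (V → ℂ) :=
  Algebra.adjoin ℂ (Set.range fun (l : Module.Dual ℂ V) (v : V) => l v)

/-- The Zariski topology on a (finite-dimensional) complex vector space. -/
abbrev zariski (V : Type) [AddCommGroup V] [Module ℂ V] : TopologicalSpace V :=
  generateFrom {U | ∃ h ∈ polyFunctions V, U = {v | h v ≠ 0}}

/-- The vector space of tuples of `n` binary forms of degree `k`. -/
abbrev BinaryForms (n k : ℕ) : Type :=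
  Fin n → MvPolynomial.homogeneousSubmodule (Fin 2) ℂ k

/-- The values of a tuple of binary forms. -/
def BinaryForms.value {n k : ℕ} (f : BinaryForms n k) (t : Fin 2 → ℂ) : Fin n → ℂ :=
  fun i => MvPolynomial.eval t (f i).1

/-- A parametrized rational curve of bidegree `(a, b)` in `ℙ¹ × ℙ²`: a morphism
`ℙ¹ ⟶ ℙ¹ × ℙ²`, `t ↦ ((f₀ t : f₁ t), (g₀ t : g₁ t : g₂ t))`, where the binary forms `fᵢ` of degree
`a` have no common zero in `ℙ¹`, and the binary forms `gⱼ` of degree `b` have no common zero. So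
`𝒪(1, 0)` and `𝒪(0, 1)` have degrees `a` and `b` on the parametrizing line. For coprime `a`, `b` the
morphism is birational onto its image, because the degree over the image divides `a` and `b`. -/
structure RationalCurve (a b : ℕ) where
  /-- the forms that define the morphism, as a point of a vector space -/
  forms : BinaryForms 2 a × BinaryForms 3 b
  fst_ne (t : Fin 2 → ℂ) : t ≠ 0 → forms.1.value t ≠ 0
  snd_ne (t : Fin 2 → ℂ) : t ≠ 0 → forms.2.value t ≠ 0

/-- The Zariski topology on the space of parametrized rational curves, as a subspace of the vector
space of forms (in which it is a nonempty open subset, hence irreducible). -/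
instance (a b : ℕ) : TopologicalSpace (RationalCurve a b) :=
  (zariski (BinaryForms 2 a × BinaryForms 3 b)).induced RationalCurve.forms

/-- The rational curve as a subset of `ℙ¹ × ℙ²`: the image of its parametrization. -/
def RationalCurve.carrier {a b : ℕ} (c : RationalCurve a b) : Set Pt :=
  {p | ∃ (t : Fin 2 → ℂ) (ht : t ≠ 0),
    proj (⟨c.forms.1.value t, c.fst_ne t ht⟩, ⟨c.forms.2.value t, c.snd_ne t ht⟩) = p}

/-- The degrees of `𝒪(-1, -4)^2`. -/
def syzDeg : Fin 2 → ℤ × ℤ := ![(-1, -4), (-1, -4)]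

/-- The degrees of `𝒪(0, -2) ⊕ 𝒪(-1, -3)^2`. -/
def genDeg : Fin 3 → ℤ × ℤ := ![(0, -2), (-1, -3), (-1, -3)]

end ProjLinePlane

end

/-!
Let `t` run through `ℂ²`. The lower two rows of a matrix `M` give two linear forms on the plane with
coefficients linear in `t`; their common zero is a point `g t` of the conic where the lower `2 × 2`
minor vanishes. The product of the top row with `t`, at `g t`, is a linear form on the line, and
its zero is a point `f t`. Thus `t` spans the kernel of `M` at `(f t, g t)`, and the image of
`(f, g)` is the curve where the rank of `M` is one.

If the conic is smooth, its equation is prime, and the minors of `M` that vanish on the curve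
present its ideal: a relation between them is a combination of the columns of `M` by the
Hilbert–Burch theorem, and they generate the ideal of the curve locally because away from the conic
the lower minor is invertible, whereas near the conic another minor can be solved for the
coordinates of the line, which leaves a form in the coordinates of the plane that vanishes on the
conic.

Finally `M ↦ (f, g)` is polynomial, and onto the pairs with a smooth conic: such a `g` is the
Veronese embedding in suitable coordinates, so that every binary form of degree `5` is
`q₀ t₀ + q₁ t₁` for quadratic forms `q₀`, `q₁` on the plane. Hence general curves and general
matrices correspond.
-/

noncomputable section

namespace ProjLinePlane

/-! ### Short exact sequences of sheaves of modules -/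

section sheaves

universe u

variable {T : TopCat.{u}} {R : Sheaf (Opens.grothendieckTopology T) RingCat.{u}}
  {A B : SheafOfModules.{u} R}

lemma epi_of_locally_surjective (φ : A ⟶ B)
    (h : ∀ (U : Opens T) (s : B.val.obj (op U)), ∀ p ∈ U, ∃ (V : Opens T) (i : V ⟶ U), p ∈ V ∧
      ∃ t : A.val.obj (op V), φ.val.app (op V) t = B.val.map i.op s) : Epi φ := by
  have : Sheaf.IsLocallySurjective ((SheafOfModules.toSheaf R).map φ) := by
    refine ⟨fun {U} s p hp => ?_⟩
    obtain ⟨V, i, hV, t, ht⟩ := h U s p hp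
    exact ⟨V, i, ⟨t, ht⟩, hV⟩
  have : Epi ((SheafOfModules.toSheaf R).map φ) := inferInstance
  exact (SheafOfModules.toSheaf R).epi_of_epi_map this

lemma mono_of_app_injective (φ : A ⟶ B)
    (h : ∀ U : Opens T, Function.Injective (φ.val.app (op U))) : Mono φ :=
  (SheafOfModules.forget R).mono_of_mono_map
    (PresheafOfModules.mono_of_injective fun U => h U.unop)

lemma app_injective_of_mono (φ : A ⟶ B) [Mono φ] (U : Opens T) :
    Function.Injective (φ.val.app (op U)) := by
  have : Mono ((SheafOfModules.evaluation R (op U)).map φ) := inferInstance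
  exact (ModuleCat.mono_iff_injective _).1 this

lemma shortExact_of_locally_exact (S : ShortComplex (SheafOfModules.{u} R))
    (hf : ∀ U : Opens T, Function.Injective (S.f.val.app (op U)))
    (hS : ∀ (U : Opens T) (s : S.X₂.val.obj (op U)), S.g.val.app (op U) s = 0 → ∀ p ∈ U,
      ∃ (V : Opens T) (i : V ⟶ U), p ∈ V ∧
        ∃ t : S.X₁.val.obj (op V), S.f.val.app (op V) t = S.X₂.val.map i.op s)
    (hg : ∀ (U : Opens T) (s : S.X₃.val.obj (op U)), ∀ p ∈ U,
      ∃ (V : Opens T) (i : V ⟶ U), p ∈ V ∧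
        ∃ t : S.X₂.val.obj (op V), S.g.val.app (op V) t = S.X₃.val.map i.op s) :
    S.ShortExact := by
  refine { exact := ?_, mono_f := mono_of_app_injective _ hf,
           epi_g := epi_of_locally_surjective _ hg }
  rw [S.exact_iff_epi_kernel_lift]
  refine epi_of_locally_surjective _ fun U s p hp => ?_
  have hs : S.g.val.app (op U) ((Limits.kernel.ι S.g).val.app (op U) s) = 0 :=
    congrArg (fun φ => φ.val.app (op U) s) (Limits.kernel.condition S.g)
  obtain ⟨V, i, hV, t, ht⟩ := hS U _ hs p hp
  refine ⟨V, i, hV, t, app_injective_of_mono (Limits.kernel.ι S.g) V ?_⟩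
  have lift_ι := congrArg (fun φ => φ.val.app (op V) t) (Limits.kernel.lift_ι S.g S.f S.zero)
  have restrict_ι := PresheafOfModules.naturality_apply (Limits.kernel.ι S.g).val i.op s
  exact (lift_ι.trans ht).trans restrict_ι.symm

end sheaves

/-! ### Bihomogeneous forms -/

section graded

open DirectSum

lemma exists_homogeneous_solution {ι κ G S A : Type*} [Fintype κ] [DecidableEq G]
    [AddLeftCancelMonoid G] [Semiring A] [SetLike S A] [AddSubmonoidClass S A] (𝒜 : G → S)
    [GradedRing 𝒜] {a : ι → κ → G} {b : κ → G} {c : ι → G} (hd : ∀ i k, a i k + b k = c i)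
    {M : ι → κ → A} (hM : ∀ i k, M i k ∈ 𝒜 (a i k)) {F : ι → A} (hF : ∀ i, F i ∈ 𝒜 (c i))
    (hs : ∃ u : κ → A, ∀ i, F i = ∑ k, M i k * u k) :
    ∃ u : ∀ k, 𝒜 (b k), ∀ i, F i = ∑ k, M i k * (u k : A) := by
  obtain ⟨u, hu⟩ := hs
  refine ⟨fun k => decompose 𝒜 (u k) (b k), fun i => ?_⟩
  calc F i = decompose 𝒜 (∑ k, M i k * u k) (c i) := by
        rw [← hu i, decompose_of_mem_same 𝒜 (hF i)]
    _ = ∑ k, (decompose 𝒜 (M i k * u k) (c i) : A) := by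
        rw [decompose_sum, DFinsupp.finsetSum_apply, AddSubmonoidClass.coe_finsetSum]
    _ = _ := Finset.sum_congr rfl fun k _ => by
        rw [← hd i k, coe_decompose_mul_add_of_left_mem 𝒜 (hM i k)]

instance : GradedAlgebra Forms := MvPolynomial.weightedGradedAlgebra ℂ bideg

end graded

lemma weight_bideg (μ : Fin 2 ⊕ Fin 3 →₀ ℕ) :
    Finsupp.weight bideg μ = ((μ (.inl 0) + μ (.inl 1) : ℤ),
      (μ (.inr 0) + μ (.inr 1) + μ (.inr 2) : ℤ)) := by
  rw [Finsupp.weight_apply, Finsupp.sum_fintype _ _ (by simp), Fintype.sum_sum_type,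
    Fin.sum_univ_two, Fin.sum_univ_three]
  ext <;> simp [bideg]

lemma exponents_of_mem {d : ℤ × ℤ} {F : Cox} (hF : F ∈ Forms d) {μ : Fin 2 ⊕ Fin 3 →₀ ℕ}
    (hμ : μ ∈ F.support) : (μ (.inl 0) + μ (.inl 1) : ℤ) = d.1 ∧
      (μ (.inr 0) + μ (.inr 1) + μ (.inr 2) : ℤ) = d.2 := by
  have h : Finsupp.weight bideg μ = d := hF (MvPolynomial.mem_support_iff.1 hμ)
  rw [weight_bideg] at h
  exact ⟨congrArg Prod.fst h, congrArg Prod.snd h⟩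

lemma totalDegree_le_of_mem {d : ℤ × ℤ} {F : Cox} (hF : F ∈ Forms d) :
    (F.totalDegree : ℤ) ≤ max 0 (d.1 + d.2) := by
  refine le_max_iff.2 (F.support.eq_empty_or_nonempty.imp (fun h => ?_) fun h => ?_)
  · simp [MvPolynomial.support_eq_empty.1 h]
  · obtain ⟨μ, hμ, hdeg⟩ := Finset.exists_mem_eq_sup _ h fun μ => μ.sum fun _ e => e
    obtain ⟨h1, h2⟩ := exponents_of_mem hF hμ
    rw [MvPolynomial.totalDegree, hdeg, Finsupp.sum_fintype _ _ (by simp), Fintype.sum_sum_type,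
      Fin.sum_univ_two, Fin.sum_univ_three]
    push_cast
    omega

section evalAt

variable {A : Type*} [CommRing A] [Algebra ℂ A]

/-- Substitution of elements of a `ℂ`-algebra for the homogeneous coordinates. With `A = ℂ` these
are the values of polynomials at points of `ℂ² × ℂ³`. -/
def evalAt (s : Fin 2 → A) (x : Fin 3 → A) : Cox →ₐ[ℂ] A := MvPolynomial.aeval (Sum.elim s x)

lemma val_eq_evalAt (F : Cox) (y : Coord) : val F y = evalAt y.1.1 y.2.1 F := by
  rw [val, evalAt, MvPolynomial.aeval_eq_eval]

lemma val_sum {ι : Type*} (s : Finset ι) (F : ι → Cox) (y : Coord) :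
    val (∑ i ∈ s, F i) y = ∑ i ∈ s, val (F i) y := by simp [val]

@[simp]
lemma evalAt_X_inl (s : Fin 2 → A) (x : Fin 3 → A) (i : Fin 2) :
    evalAt s x (MvPolynomial.X (.inl i)) = s i := by simp [evalAt]

@[simp]
lemma evalAt_X_inr (s : Fin 2 → A) (x : Fin 3 → A) (k : Fin 3) :
    evalAt s x (MvPolynomial.X (.inr k)) = x k := by simp [evalAt]

lemma evalAt_X (F : Cox) :
    evalAt (fun i => MvPolynomial.X (.inl i)) (fun k => MvPolynomial.X (.inr k)) F = F := by
  rw [evalAt, show Sum.elim _ _ = MvPolynomial.X by ext (i | k) <;> rfl, MvPolynomial.aeval_X_left,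
    AlgHom.id_apply]

lemma map_evalAt {B : Type*} [CommRing B] [Algebra ℂ B] (φ : A →ₐ[ℂ] B) (s : Fin 2 → A)
    (x : Fin 3 → A) (F : Cox) : φ (evalAt s x F) = evalAt (φ ∘ s) (φ ∘ x) F := by
  rw [evalAt, evalAt, MvPolynomial.comp_aeval_apply, ← Function.comp_def, Sum.comp_elim]

lemma dvd_evalAt_sub_evalAt {a : A} {s s' : Fin 2 → A} (h : ∀ i, a ∣ s i - s' i) (x : Fin 3 → A)
    (F : Cox) : a ∣ evalAt s x F - evalAt s' x F := by
  let π := Ideal.Quotient.mkₐ ℂ (Ideal.span {a})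
  have dvd_sub_iff (b c : A) : a ∣ b - c ↔ π b = π c := by
    rw [← Ideal.mem_span_singleton]
    exact Ideal.Quotient.eq.symm
  simp only [dvd_sub_iff] at h ⊢
  rw [map_evalAt, map_evalAt, show π ∘ s = π ∘ s' from funext h]

lemma evalAt_eq_sum (F : Cox) (s : Fin 2 → A) (x : Fin 3 → A) : evalAt s x F =
    ∑ μ ∈ F.support, F.coeff μ • (s 0 ^ μ (.inl 0) * s 1 ^ μ (.inl 1) *
      (x 0 ^ μ (.inr 0) * x 1 ^ μ (.inr 1) * x 2 ^ μ (.inr 2))) := by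
  simp only [evalAt, MvPolynomial.aeval_def, MvPolynomial.eval₂_eq', Fintype.prod_sum_type,
    Fin.prod_univ_two, Fin.prod_univ_three, Sum.elim_inl, Sum.elim_inr, Algebra.smul_def]

lemma evalAt_smul {d : ℤ × ℤ} {F : Cox} (hF : F ∈ Forms d) (a b : A) (s : Fin 2 → A)
    (x : Fin 3 → A) :
    evalAt (a • s) (b • x) F = a ^ d.1.toNat * b ^ d.2.toNat * evalAt s x F := by
  rw [evalAt_eq_sum, evalAt_eq_sum, Finset.mul_sum]
  refine Finset.sum_congr rfl fun μ hμ => ?_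
  obtain ⟨h1, h2⟩ := exponents_of_mem hF hμ
  rw [show d.1.toNat = μ (.inl 0) + μ (.inl 1) by omega,
    show d.2.toNat = μ (.inr 0) + μ (.inr 1) + μ (.inr 2) by omega, mul_smul_comm]
  simp only [Pi.smul_apply, smul_eq_mul]
  congr 1
  ring

lemma evalAt_congr_fst {n : ℤ} {F : Cox} (hF : F ∈ Forms (0, n)) (s s' : Fin 2 → A)
    (x : Fin 3 → A) : evalAt s x F = evalAt s' x F := by
  have eq_zero (s : Fin 2 → A) : evalAt s x F = evalAt 0 x F := by
    have h := evalAt_smul hF 0 1 s x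
    simp only [Int.toNat_zero, zero_smul, one_smul, pow_zero, one_pow, one_mul] at h
    exact h.symm
  rw [eq_zero s, eq_zero s']

lemma evalAt_of_mem_one {n : ℤ} {F : Cox} (hF : F ∈ Forms (1, n)) (s : Fin 2 → A)
    (x : Fin 3 → A) :
    evalAt s x F = s 0 * evalAt ![1, 0] x F + s 1 * evalAt ![0, 1] x F := by
  simp only [evalAt_eq_sum, Finset.mul_sum, ← Finset.sum_add_distrib]
  refine Finset.sum_congr rfl fun μ hμ => ?_
  obtain ⟨h1, -⟩ := exponents_of_mem hF hμ
  simp only at h1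
  obtain ⟨h2, h3⟩ | ⟨h2, h3⟩ : (μ (.inl 0) = 0 ∧ μ (.inl 1) = 1) ∨
      (μ (.inl 0) = 1 ∧ μ (.inl 1) = 0) := by omega
  all_goals simp [h2, h3]

lemma evalAt_mem {ι : Type*} [AddCommMonoid ι] {𝒜 : ι → Submodule ℂ A} [SetLike.GradedMonoid 𝒜]
    {d : ℤ × ℤ} {F : Cox} (hF : F ∈ Forms d) {e e' : ι} {s : Fin 2 → A} {x : Fin 3 → A}
    (hs : ∀ i, s i ∈ 𝒜 e) (hx : ∀ k, x k ∈ 𝒜 e') :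
    evalAt s x F ∈ 𝒜 (d.1.toNat • e + d.2.toNat • e') := by
  rw [evalAt_eq_sum]
  refine Submodule.sum_mem _ fun μ hμ => Submodule.smul_mem _ _ ?_
  obtain ⟨h1, h2⟩ := exponents_of_mem hF hμ
  rw [show d.1.toNat = μ (.inl 0) + μ (.inl 1) by omega,
    show d.2.toNat = μ (.inr 0) + μ (.inr 1) + μ (.inr 2) by omega]
  simp only [add_smul]
  have hs' i := SetLike.pow_mem_graded (μ (.inl i)) (hs i)
  have hx' k := SetLike.pow_mem_graded (μ (.inr k)) (hx k)
  exact SetLike.mul_mem_graded (SetLike.mul_mem_graded (hs' 0) (hs' 1))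
    (SetLike.mul_mem_graded (SetLike.mul_mem_graded (hx' 0) (hx' 1)) (hx' 2))

lemma evalAt_of_mem_zero_one {F : Cox} (hF : F ∈ Forms (0, 1)) (s : Fin 2 → A) (x : Fin 3 → A) :
    evalAt s x F = ∑ k, evalAt (0 : Fin 2 → ℂ) (Pi.single k 1) F • x k := by
  simp only [evalAt_eq_sum, Finset.sum_smul]
  rw [Finset.sum_comm]
  refine Finset.sum_congr rfl fun μ hμ => ?_
  obtain ⟨h1, h2⟩ := exponents_of_mem hF hμ
  simp only at h1 h2
  have h3 : μ (.inl 0) = 0 ∧ μ (.inl 1) = 0 := by omega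
  obtain h | h | h : (μ (.inr 0) = 1 ∧ μ (.inr 1) = 0 ∧ μ (.inr 2) = 0) ∨
      (μ (.inr 0) = 0 ∧ μ (.inr 1) = 1 ∧ μ (.inr 2) = 0) ∨
      (μ (.inr 0) = 0 ∧ μ (.inr 1) = 0 ∧ μ (.inr 2) = 1) := by omega
  all_goals simp [h3, h, Fin.sum_univ_three]

end evalAt

/-! ### Sections as fractions -/

section fractions

variable {d e : ℤ × ℤ} {U : Opens X} {p : Pt}

lemma exists_proj_eq (p : Pt) : ∃ y : Coord, proj y = p :=
  ⟨(⟨p.fst.rep, p.fst.rep_nonzero⟩, ⟨p.snd.rep, p.snd.rep_nonzero⟩),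
    Pt.ext (Projectivization.mk_rep _) (Projectivization.mk_rep _)⟩

lemma val_ne_zero_of_proj_eq (F : Forms d) {y z : Coord} (h : proj y = proj z)
    (hy : val F y ≠ 0) : val F z ≠ 0 := by
  obtain ⟨a, ha⟩ := (Projectivization.mk_eq_mk_iff' ℂ _ _ y.1.2 z.1.2).1 (congrArg Pt.fst h)
  obtain ⟨b, hb⟩ := (Projectivization.mk_eq_mk_iff' ℂ _ _ y.2.2 z.2.2).1 (congrArg Pt.snd h)
  rw [val_eq_evalAt, ← ha, ← hb, evalAt_smul F.2] at hy
  rw [val_eq_evalAt]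
  exact right_ne_zero_of_mul hy

/-- The open set where a form does not vanish. -/
def basicOpen (G : Forms d) : Opens X :=
  ⟨{p | ∀ y, proj y = p → val G y ≠ 0}, .basic _ ⟨d, G, rfl⟩⟩

lemma proj_mem_basicOpen {G : Forms d} {y : Coord} : proj y ∈ basicOpen G ↔ val G y ≠ 0 :=
  ⟨fun h => h y rfl, fun h _ hz => val_ne_zero_of_proj_eq G hz.symm h⟩

lemma basicOpen_mul (G : Forms d) (H : Forms e) :
    basicOpen ⟨G * H, mul_mem G.2 H.2⟩ = basicOpen G ⊓ basicOpen H := by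
  ext p
  obtain ⟨y, rfl⟩ := exists_proj_eq p
  change proj y ∈ basicOpen _ ↔ proj y ∈ basicOpen G ∧ proj y ∈ basicOpen H
  rw [proj_mem_basicOpen, proj_mem_basicOpen, proj_mem_basicOpen, val_mul, mul_ne_zero_iff]

lemma exists_basicOpen_le (hp : p ∈ U) :
    ∃ (e : ℤ × ℤ) (G : Forms e), p ∈ basicOpen G ∧ basicOpen G ≤ U := by
  obtain ⟨U, hU⟩ := U
  change p ∈ U at hp
  suffices ∃ (e : ℤ × ℤ) (G : Forms e), p ∈ basicOpen G ∧ (basicOpen G : Set Pt) ⊆ U from this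
  induction hU with
  | basic s hs =>
    obtain ⟨d, G, rfl⟩ := hs
    exact ⟨d, G, hp, subset_rfl⟩
  | univ =>
    obtain ⟨y, rfl⟩ := exists_proj_eq p
    exact ⟨0, ⟨1, MvPolynomial.isWeightedHomogeneous_one ℂ bideg⟩,
      proj_mem_basicOpen.2 (by simp [val]), Set.subset_univ _⟩
  | inter s t _ _ hs ht =>
    obtain ⟨d, G, hG, hGs⟩ := hs hp.1
    obtain ⟨e, H, hH, hHt⟩ := ht hp.2
    refine ⟨d + e, ⟨G * H, mul_mem G.2 H.2⟩, ?_⟩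
    rw [basicOpen_mul]
    exact ⟨⟨hG, hH⟩, Set.inter_subset_inter hGs hHt⟩
  | sUnion S _ ih =>
    obtain ⟨s, hs, hps⟩ := hp
    obtain ⟨d, G, hG, hGs⟩ := ih s hs hps
    exact ⟨d, G, hG, hGs.trans (Set.subset_sUnion_of_mem hs)⟩

lemma eq_zero_of_val_eq_zero {F H : Cox} (hH : H ≠ 0) (h : ∀ y, val H y ≠ 0 → val F y = 0) :
    F = 0 := by
  have : F * H * MvPolynomial.X (.inl 0) * MvPolynomial.X (.inr 0) = 0 := by
    refine MvPolynomial.funext fun v => ?_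
    rw [map_zero, map_mul, map_mul, map_mul, MvPolynomial.eval_X, MvPolynomial.eval_X]
    by_contra hne
    have hs := right_ne_zero_of_mul (left_ne_zero_of_mul hne)
    have hx := right_ne_zero_of_mul hne
    have hFH := left_ne_zero_of_mul (left_ne_zero_of_mul hne)
    rw [← Sum.elim_comp_inl_inr v] at hFH
    exact left_ne_zero_of_mul hFH (h ⟨⟨v ∘ .inl, fun h => hs (congrFun h 0)⟩,
      ⟨v ∘ .inr, fun h => hx (congrFun h 0)⟩⟩ (right_ne_zero_of_mul hFH))
  simpa [hH, MvPolynomial.X_ne_zero] using this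

lemma ne_zero_of_mem_basicOpen {G : Forms d} (hp : p ∈ basicOpen G) : (G : Cox) ≠ 0 := by
  obtain ⟨y, rfl⟩ := exists_proj_eq p
  intro h
  exact proj_mem_basicOpen.1 hp (by simp [h, val])

lemma isSection_div (F : Forms (e + d)) (G : Forms e) (hU : U ≤ basicOpen G) :
    IsSection d (fun y : Over U => val F y.1 / val G y.1) := fun _ hp =>
  ⟨U, le_rfl, e, F, G, hp, fun y => ⟨proj_mem_basicOpen.1 (hU y.2), rfl⟩⟩

lemma IsSection.exists_fraction {σ : Over U → ℂ} (hσ : IsSection d σ) (hp : p ∈ U) :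
    ∃ (e : ℤ × ℤ) (G : Forms e) (h : basicOpen G ≤ U), p ∈ basicOpen G ∧ ∃ F : Forms (e + d),
      ∀ y : Over (basicOpen G), σ ⟨y.1, h y.2⟩ = val F y.1 / val G y.1 := by
  obtain ⟨V, hV, e, F, G, hpV, H⟩ := hσ p hp
  obtain ⟨e', G', hpG', hG'⟩ := exists_basicOpen_le hpV
  have le_V : basicOpen ⟨G * G', mul_mem G.2 G'.2⟩ ≤ V := by
    rw [basicOpen_mul]
    exact inf_le_right.trans hG'
  refine ⟨e + e', ⟨G * G', mul_mem G.2 G'.2⟩, le_V.trans hV, ?_,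
    ⟨F * G', by simpa only [add_right_comm] using mul_mem F.2 G'.2⟩, fun y => ?_⟩
  · obtain ⟨y, rfl⟩ := exists_proj_eq p
    rw [basicOpen_mul]
    exact ⟨proj_mem_basicOpen.2 (H ⟨y, hpV⟩).1, hpG'⟩
  · have hy := proj_mem_basicOpen.1 y.2
    rw [val_mul] at hy
    exact (H ⟨y.1, le_V y.2⟩).2.trans (by
      rw [val_mul, val_mul, mul_div_mul_right _ _ (right_ne_zero_of_mul hy)])

lemma exists_fractions {ι : Type*} [Finite ι] {d : ι → ℤ × ℤ} {σ : ι → Over U → ℂ}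
    (hσ : ∀ j, IsSection (d j) (σ j)) (hp : p ∈ U) :
    ∃ (e : ℤ × ℤ) (G : Forms e) (h : basicOpen G ≤ U), p ∈ basicOpen G ∧
      ∃ F : ∀ j, Forms (e + d j), ∀ j, ∀ y : Over (basicOpen G),
        σ j ⟨y.1, h y.2⟩ = val (F j) y.1 / val G y.1 := by
  classical
  cases nonempty_fintype ι
  choose a G hGU hpG F H using fun j => (hσ j).exists_fraction hp
  obtain ⟨a', G', hpG', hG'⟩ := exists_basicOpen_le hp
  have prod_mem (s : Finset ι) : ∏ j ∈ s, (G j : Cox) ∈ Forms (∑ j ∈ s, a j) :=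
    SetLike.prod_mem_graded _ _ _ fun j _ => (G j).2
  obtain ⟨K, hK⟩ : ∃ K : Forms (∑ j, a j + a'), (K : Cox) = (∏ j, (G j : Cox)) * G' :=
    ⟨⟨_, mul_mem (prod_mem _) G'.2⟩, rfl⟩
  have val_K (y : Coord) : val K y = (∏ j, val (G j) y) * val G' y := by simp [hK, val]
  have le_G (j : ι) : basicOpen K ≤ basicOpen (G j) := fun q hq => by
    obtain ⟨y, rfl⟩ := exists_proj_eq q
    rw [proj_mem_basicOpen, val_K] at hq
    exact proj_mem_basicOpen.2 (Finset.prod_ne_zero_iff.1 (left_ne_zero_of_mul hq) j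
      (Finset.mem_univ j))
  have le_U : basicOpen K ≤ U := fun q hq => hG' <| by
    obtain ⟨y, rfl⟩ := exists_proj_eq q
    rw [proj_mem_basicOpen, val_K] at hq
    exact proj_mem_basicOpen.2 (right_ne_zero_of_mul hq)
  refine ⟨_, K, le_U, ?_, fun j =>
    ⟨F j * ((∏ i ∈ Finset.univ.erase j, (G i : Cox)) * G'), ?_⟩, fun j y => ?_⟩
  · obtain ⟨y, rfl⟩ := exists_proj_eq p
    rw [proj_mem_basicOpen, val_K]
    exact mul_ne_zero (Finset.prod_ne_zero_iff.2 fun j _ => proj_mem_basicOpen.1 (hpG j))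
      (proj_mem_basicOpen.1 hpG')
  · convert mul_mem (F j).2 (mul_mem (prod_mem (Finset.univ.erase j)) G'.2) using 2
    rw [← Finset.add_sum_erase _ a (Finset.mem_univ j)]
    abel
  · have hy := proj_mem_basicOpen.1 y.2
    rw [val_K, ← Finset.mul_prod_erase _ _ (Finset.mem_univ j), mul_assoc] at hy
    rw [H j ⟨y.1, le_G j y.2⟩, val_K, ← Finset.mul_prod_erase _ _ (Finset.mem_univ j), mul_assoc,
      ← mul_div_mul_right _ _ (right_ne_zero_of_mul hy)]
    simp [val]

lemma sum_mul_eq_zero_of_val_div {ι : Type*} [Fintype ι] {A F : ι → Cox} {G : Cox} (hG : G ≠ 0)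
    (h : ∀ y, val G y ≠ 0 → ∑ i, val (A i) y * (val (F i) y / val G y) = 0) :
    ∑ i, A i * F i = 0 := by
  refine eq_zero_of_val_eq_zero hG fun y hy => ?_
  have := h y hy
  simp only [← mul_div_assoc, ← Finset.sum_div] at this
  simpa only [val_sum, val_mul] using (div_eq_zero_iff.1 this).resolve_right hy

end fractions

/-! ### Complexes of forms and short exact sequences of sheaves -/

section complex

open Matrix

variable {m n : ℕ} {e : Fin n → ℤ × ℤ} {d : Fin m → ℤ × ℤ}

/-- The matrix of polynomials underlying a matrix of bihomogeneous forms. -/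
def polyMatrix (M : FormMatrix e d) : Matrix (Fin m) (Fin n) Cox :=
  Matrix.of fun i j => (M i j : Cox)

/-- A row of forms that vanish on `C` defines a morphism to the ideal sheaf of `C`. -/
def rowHom (R : (i : Fin m) → Forms (0 - d i)) (C : Set Pt)
    (hR : ∀ i y, proj y ∈ C → val (R i) y = 0) : twistSum d ⟶ idealSheaf C where
  val := PresheafOfModules.homMk
    { app := fun U => AddCommGrpCat.ofHom
        (X := (twistSumFunctions d).sec U.unop) (Y := (idealFunctions C).sec U.unop)
        { toFun := fun σ => ⟨fun y => ∑ i, val (R i) y.1 * σ.1 y i,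
            isSection_mulVec (d := fun _ : Fin 1 => 0) (fun _ => R) σ.1 σ.2 0,
            fun y hy => Finset.sum_eq_zero fun i _ => by rw [hR i y.1 hy, zero_mul]⟩
          map_zero' := Subtype.ext <| funext fun y => by simp
          map_add' := fun σ τ => Subtype.ext <| funext fun y => by
            simp [mul_add, Finset.sum_add_distrib] }
      naturality := fun _ _ _ => rfl }
    (fun U r σ => Subtype.ext <| funext fun y => by
      change ∑ i, val (R i) y.1 * (r.1 y * σ.1 y i) = r.1 y * ∑ i, val (R i) y.1 * σ.1 y i
      rw [Finset.mul_sum]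
      exact Finset.sum_congr rfl fun j _ => by ring)

/-- The row `R` of forms generates the ideal of `C` in the local rings of `ℙ¹ × ℙ²`: near the point
with coordinates `y`, a form that vanishes on `C` gets into the ideal generated by the entries of
`R` after multiplication by a form `D` with `D y ≠ 0`. -/
def GeneratesLocally (R : Fin m → Cox) (C : Set Pt) : Prop :=
  ∀ (δ : ℤ × ℤ) (P : Forms δ), (∀ y, proj y ∈ C → val P y = 0) → ∀ y : Coord,
    ∃ (ε : ℤ × ℤ) (D : Forms ε), val D y ≠ 0 ∧ (D * P : Cox) ∈ Ideal.span (Set.range R)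

variable {M : FormMatrix e d} {R : (i : Fin m) → Forms (0 - d i)} {C : Set Pt}

lemma matrixHom_comp_rowHom (hC : ∀ i y, proj y ∈ C → val (R i) y = 0)
    (hRM : (fun i => (R i : Cox)) ᵥ* polyMatrix M = 0) : matrixHom M ≫ rowHom R C hC = 0 := by
  refine SheafOfModules.hom_ext (PresheafOfModules.hom_ext fun U => ModuleCat.hom_ext
    (LinearMap.ext fun (σ : (twistSumFunctions e).sec U.unop) => Subtype.ext (funext fun y => ?_)))
  have hRM' (j : Fin n) : ∑ i, val (R i) y.1 * val (M i j) y.1 = 0 := by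
    have := congrArg (fun F => val F y.1) (congrFun hRM j)
    simpa [vecMul, dotProduct, polyMatrix, val] using this
  change ∑ i, val (R i) y.1 * ∑ j, val (M i j) y.1 * σ.1 y j = 0
  simp only [Finset.mul_sum, ← mul_assoc]
  rw [Finset.sum_comm]
  simp only [← Finset.sum_mul, hRM', zero_mul, Finset.sum_const_zero]

lemma matrixHom_app_injective (hM : ∀ u, polyMatrix M *ᵥ u = 0 → u = 0) (U : Opens X) :
    Function.Injective ((matrixHom M).val.app (op U)) := by
  refine (injective_iff_map_eq_zero ((matrixHom M).val.app (op U)).hom).2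
    fun (σ : (twistSumFunctions e).sec U) hσ => Subtype.ext (funext fun y => funext fun j => ?_)
  have hσ' (y : Over U) (i : Fin m) : ∑ j, val (M i j) y.1 * σ.1 y j = 0 :=
    congrFun (congrFun (congrArg Subtype.val hσ) y) i
  obtain ⟨a, G, h, hG, F, hF⟩ := exists_fractions σ.2 y.2
  have MF_eq_zero (i : Fin m) : ∑ j, (M i j * F j : Cox) = 0 :=
    sum_mul_eq_zero_of_val_div (ne_zero_of_mem_basicOpen hG) fun z hz => by
      rw [← hσ' ⟨z, h (proj_mem_basicOpen.2 hz)⟩ i]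
      exact Finset.sum_congr rfl fun j _ => by rw [hF j ⟨z, proj_mem_basicOpen.2 hz⟩]
  have F_eq_zero : (fun j => (F j : Cox)) = 0 := hM _ (funext MF_eq_zero)
  refine (hF j ⟨y.1, hG⟩).trans ?_
  rw [show (F j : Cox) = 0 from congrFun F_eq_zero j, val, map_zero, zero_div]
  rfl

lemma exists_local_preimage_matrixHom
    (hexact : ∀ F, (fun i => (R i : Cox)) ⬝ᵥ F = 0 → ∃ u, F = polyMatrix M *ᵥ u)
    {U : Opens X} (σ : (twistSumFunctions d).sec U)
    (hσ : ∀ y : Over U, ∑ i, val (R i) y.1 * σ.1 y i = 0) {p : Pt} (hp : p ∈ U) :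
    ∃ (V : Opens X) (h : V ≤ U), p ∈ V ∧
      ∃ τ : (twistSumFunctions e).sec V, ∀ y : Over V, ∀ i,
        ∑ j, val (M i j) y.1 * τ.1 y j = σ.1 ⟨y.1, h y.2⟩ i := by
  obtain ⟨a, G, h, hG, F, hF⟩ := exists_fractions σ.2 hp
  obtain ⟨u, hu⟩ := hexact (fun i => F i) <|
    sum_mul_eq_zero_of_val_div (ne_zero_of_mem_basicOpen hG) fun z hz => by
      rw [← hσ ⟨z, h (proj_mem_basicOpen.2 hz)⟩]
      exact Finset.sum_congr rfl fun j _ => by rw [hF j ⟨z, proj_mem_basicOpen.2 hz⟩]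
  obtain ⟨v, hv⟩ := exists_homogeneous_solution Forms (b := fun j => a + e j)
    (fun i j => by abel) (fun i j => (M i j).2) (fun i => (F i).2) ⟨u, fun i => congrFun hu i⟩
  refine ⟨basicOpen G, h, hG, ⟨fun y j => val (v j) y.1 / val G y.1,
    fun j => isSection_div (v j) G le_rfl⟩, fun y i => ?_⟩
  rw [hF i y, hv i, val_sum, Finset.sum_div]
  exact Finset.sum_congr rfl fun j _ => by rw [val_mul, mul_div_assoc]

lemma exists_fraction_of_mem_idealFunctions {U : Opens X} (σ : (idealFunctions C).sec U) {p : Pt}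
    (hp : p ∈ U) : ∃ (a : ℤ × ℤ) (F G : Forms a) (h : basicOpen G ≤ U), p ∈ basicOpen G ∧
      (∀ y : Over (basicOpen G), σ.1 ⟨y.1, h y.2⟩ = val F y.1 / val G y.1) ∧
      ∀ y, proj y ∈ C → val (F * G) y = 0 := by
  obtain ⟨a, G, h, hG, F, hF⟩ := σ.2.1.exists_fraction hp
  refine ⟨a, ⟨F, by simpa only [add_zero] using F.2⟩, G, h, hG, hF, fun y hy => ?_⟩
  rw [val_mul]
  by_contra hne
  have hGy := proj_mem_basicOpen.2 (right_ne_zero_of_mul hne)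
  have := hF ⟨y, hGy⟩
  rw [σ.2.2 _ hy] at this
  exact div_ne_zero (left_ne_zero_of_mul hne) (right_ne_zero_of_mul hne) this.symm

lemma GeneratesLocally.exists_local_preimage (hgen : GeneratesLocally (fun i => (R i : Cox)) C)
    {U : Opens X} (σ : (idealFunctions C).sec U) {p : Pt} (hp : p ∈ U) :
    ∃ (V : Opens X) (h : V ≤ U), p ∈ V ∧
      ∃ τ : (twistSumFunctions d).sec V, ∀ y : Over V,
        ∑ i, val (R i) y.1 * τ.1 y i = σ.1 ⟨y.1, h y.2⟩ := by
  obtain ⟨a, F, G, h, hG, hF, hFG⟩ := exists_fraction_of_mem_idealFunctions σ hp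
  obtain ⟨z, rfl⟩ := exists_proj_eq p
  obtain ⟨ε, D, hD, hmem⟩ := hgen _ ⟨_, mul_mem F.2 G.2⟩ hFG z
  obtain ⟨b', hb'⟩ := Ideal.mem_span_range_iff_exists_fun.1 hmem
  obtain ⟨b, hb⟩ := exists_homogeneous_solution Forms (b := fun i => ε + (a + a) + d i)
    (fun (_ : Unit) i => by abel) (fun _ i => (R i).2)
    (fun _ => mul_mem D.2 (mul_mem F.2 G.2)) ⟨b', fun _ => by simp only [← hb', mul_comm]⟩
  -- On the locus where `E = D * G ^ 2` does not vanish, `F / G = D * (F * G) / E`.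
  obtain ⟨E, hE⟩ : ∃ E : Forms (ε + (a + a)), (E : Cox) = D * (G * G) :=
    ⟨⟨_, mul_mem D.2 (mul_mem G.2 G.2)⟩, rfl⟩
  have hEy (y : Coord) : val E y ≠ 0 ↔ val D y ≠ 0 ∧ val G y ≠ 0 := by
    simp [hE, val_mul]
  have hle : basicOpen E ≤ basicOpen G := fun q hq => by
    obtain ⟨y, rfl⟩ := exists_proj_eq q
    exact proj_mem_basicOpen.2 ((hEy y).1 (proj_mem_basicOpen.1 hq)).2
  refine ⟨basicOpen E, hle.trans h, proj_mem_basicOpen.2 ((hEy z).2 ⟨hD, proj_mem_basicOpen.1 hG⟩),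
    ⟨fun y i => val (b i) y.1 / val E y.1, fun i => isSection_div (b i) E le_rfl⟩, fun y => ?_⟩
  obtain ⟨hDy, hGy⟩ := (hEy y.1).1 (proj_mem_basicOpen.1 y.2)
  have hby := congrArg (fun F => val F y.1) (hb ())
  simp only [val_sum, val_mul] at hby
  simp only [← mul_div_assoc, ← Finset.sum_div]
  rw [hF ⟨y.1, hle y.2⟩, ← hby, hE]
  simp only [val_mul]
  field_simp

theorem resolves_of_exact (hC : ∀ i y, proj y ∈ C → val (R i) y = 0)
    (hRM : (fun i => (R i : Cox)) ᵥ* polyMatrix M = 0)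
    (hM : ∀ u, polyMatrix M *ᵥ u = 0 → u = 0)
    (hexact : ∀ F, (fun i => (R i : Cox)) ⬝ᵥ F = 0 → ∃ u, F = polyMatrix M *ᵥ u)
    (hgen : GeneratesLocally (fun i => (R i : Cox)) C) : Resolves M C := by
  refine ⟨rowHom R C hC, matrixHom_comp_rowHom hC hRM,
    shortExact_of_locally_exact _ (matrixHom_app_injective hM) ?_ ?_⟩
  · intro U (σ : (twistSumFunctions d).sec U) hσ p hp
    obtain ⟨V, h, hV, τ, hτ⟩ := exists_local_preimage_matrixHom hexact σ
      (fun y => congrFun (congrArg Subtype.val hσ) y) hp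
    exact ⟨V, homOfLE h, hV, τ, Subtype.ext (funext fun y => funext fun i => hτ y i)⟩
  · intro U (σ : (idealFunctions C).sec U) p hp
    obtain ⟨V, h, hV, τ, hτ⟩ := hgen.exists_local_preimage σ hp
    exact ⟨V, homOfLE h, hV, τ, Subtype.ext (funext hτ)⟩

end complex

/-! ### The Hilbert–Burch theorem for `3 × 2` matrices -/

section minors

open Matrix

variable {R : Type*} [CommRing R]

lemma mul_eq_mul_of_cross_eq_zero {v w : Fin 3 → R} (h : v ⨯₃ w = 0) (i k : Fin 3) :
    v i * w k = v k * w i := by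
  rw [cross_apply] at h
  have h0 : v 1 * w 2 - v 2 * w 1 = 0 := congrFun h 0
  have h1 : v 2 * w 0 - v 0 * w 2 = 0 := congrFun h 1
  have h2 : v 0 * w 1 - v 1 * w 0 = 0 := congrFun h 2
  fin_cases i <;> fin_cases k <;> grind

lemma exists_eq_smul_cross {K : Type*} [Field K] {v w x : Fin 3 → K} (h : v ⨯₃ w ≠ 0)
    (hv : v ⬝ᵥ x = 0) (hw : w ⬝ᵥ x = 0) : ∃ b : K, x = b • (v ⨯₃ w) := by
  obtain ⟨k, hk⟩ := Function.ne_iff.1 h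
  have hx : x ⨯₃ (v ⨯₃ w) = 0 := by
    rw [cross_cross_eq_smul_sub_smul', dotProduct_comm x, hw, hv, zero_smul, zero_smul, sub_zero]
  refine ⟨x k / (v ⨯₃ w) k, funext fun i => ?_⟩
  rw [Pi.smul_apply, smul_eq_mul, div_mul_eq_mul_div, eq_div_iff hk]
  exact mul_eq_mul_of_cross_eq_zero hx i k

/-- The row of the signed maximal minors of a `3 × 2` matrix: the cross product of its columns. -/
def minors (A : Matrix (Fin 3) (Fin 2) R) : Fin 3 → R := Aᵀ 0 ⨯₃ Aᵀ 1

variable {A : Matrix (Fin 3) (Fin 2) R}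

lemma mulVec_eq_smul_add_smul (u : Fin 2 → R) : A *ᵥ u = u 0 • Aᵀ 0 + u 1 • Aᵀ 1 := by
  ext i
  simp [Matrix.mulVec, dotProduct, Fin.sum_univ_two, mul_comm]

lemma minors_vecMul : minors A ᵥ* A = 0 := by
  ext j
  change minors A ⬝ᵥ Aᵀ j = 0
  rw [dotProduct_comm]
  fin_cases j
  exacts [dot_self_cross _ _, dot_cross_self _ _]

variable [IsDomain R]

lemma eq_zero_of_mulVec_eq_zero_of_minors_ne_zero (hA : minors A ≠ 0) {u : Fin 2 → R}
    (hu : A *ᵥ u = 0) : u = 0 := by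
  rw [mulVec_eq_smul_add_smul] at hu
  have h0 := congrArg (· ⨯₃ Aᵀ 1) hu
  have h1 := congrArg (Aᵀ 0 ⨯₃ ·) hu
  simp only [map_add, map_smul, LinearMap.add_apply, LinearMap.smul_apply, cross_self, smul_zero,
    add_zero, zero_add, map_zero, LinearMap.zero_apply] at h0 h1
  ext j
  fin_cases j
  exacts [(smul_eq_zero.1 h0).resolve_right hA, (smul_eq_zero.1 h1).resolve_right hA]

lemma exists_eq_mulVec_of_minors_dotProduct_eq_zero (hp : Prime (minors A 0)) {k : Fin 3}
    (hk : ¬ minors A 0 ∣ minors A k) {w : Fin 3 → R} (hw : minors A ⬝ᵥ w = 0) :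
    ∃ u, w = A *ᵥ u := by
  have dvd_cross (j : Fin 2) : minors A 0 ∣ (w ⨯₃ Aᵀ j) 0 := by
    have hn : (w ⨯₃ Aᵀ j) ⨯₃ minors A = 0 := by
      rw [cross_cross_eq_smul_sub_smul, dotProduct_comm w, hw, dotProduct_comm (Aᵀ j),
        show minors A ⬝ᵥ Aᵀ j = 0 from congrFun minors_vecMul j, zero_smul, zero_smul, sub_zero]
    refine (hp.dvd_or_dvd ⟨(w ⨯₃ Aᵀ j) k, ?_⟩).resolve_right hk
    rw [mul_eq_mul_of_cross_eq_zero hn 0 k, mul_comm]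
  obtain ⟨a, ha⟩ := dvd_cross 1
  obtain ⟨b, hb⟩ := dvd_cross 0
  refine ⟨![a, -b], funext fun i => mul_left_cancel₀ hp.ne_zero ?_⟩
  -- Cramer's rule
  have cramer : minors A 0 * w i = (w ⨯₃ Aᵀ 1) 0 * A i 0 - (w ⨯₃ Aᵀ 0) 0 * A i 1 := by
    simp only [minors, cross_apply, vec3_dotProduct, transpose_apply, cons_val] at hw ⊢
    obtain rfl | rfl | rfl : i = 0 ∨ i = 1 ∨ i = 2 := by omega
    · linear_combination hw
    · ring
    · ring
  rw [cramer, ha, hb, mulVec_eq_smul_add_smul]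
  simp only [cons_val_zero, cons_val_one, Pi.add_apply, Pi.smul_apply, smul_eq_mul, transpose_apply]
  ring

end minors

/-! ### Binary forms -/

namespace BinaryForms

open Polynomial Matrix

variable {n k : ℕ}

lemma value_zero (hk : k ≠ 0) (f : BinaryForms n k) : f.value 0 = 0 :=
  funext fun i => by
    rw [value, MvPolynomial.eval_zero, MvPolynomial.constantCoeff_eq]
    exact MvPolynomial.IsHomogeneous.coeff_eq_zero (f i).2 (by simpa using hk.symm)

lemma ext_value {f g : BinaryForms n k} (h : ∀ t, f.value t = g.value t) : f = g :=
  funext fun i => Subtype.ext <| MvPolynomial.funext fun t => congrFun (h t) i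

/-- The polynomials obtained from binary forms by setting the second variable equal to `1`. -/
def dehomogenize : BinaryForms n k →ₗ[ℂ] Fin n → ℂ[X] :=
  LinearMap.pi fun i => (MvPolynomial.aeval ![Polynomial.X, 1]).toLinearMap ∘ₗ
    Submodule.subtype _ ∘ₗ LinearMap.proj i

lemma homogenize_dehomogenize (f : BinaryForms n k) (i : Fin n) :
    (dehomogenize f i).homogenize k = (f i).1 :=
  homogenize_eq_of_isHomogeneous (f i).2 (by simp [dehomogenize])

lemma natDegree_dehomogenize_le (f : BinaryForms n k) (i : Fin n) :
    (dehomogenize f i).natDegree ≤ k := by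
  have h := MvPolynomial.aeval_natDegree_le (f i).1 (f i).2.totalDegree_le ![Polynomial.X, 1]
    (n := 1) (Fin.forall_fin_two.2 ⟨by simp, by simp⟩)
  rwa [mul_one] at h

/-- The tuple of binary forms with the given dehomogenizations, which have degree at most `k`. -/
def ofPolynomials (p : Fin n → ℂ[X]) : BinaryForms n k :=
  fun i => ⟨(p i).homogenize k, isHomogeneous_homogenize _⟩

lemma dehomogenize_ofPolynomials {p : Fin n → ℂ[X]} (hp : ∀ i, (p i).natDegree ≤ k) :
    dehomogenize (ofPolynomials p : BinaryForms n k) = p :=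
  funext fun i => aeval_homogenize_X_one (p i) (hp i)

/-- The matrix of the coefficients of a tuple of binary forms; the entry in column `j` belongs to
the monomial `t₀ ^ j * t₁ ^ (k - j)`. -/
def coeffMatrix : BinaryForms n k →ₗ[ℂ] Matrix (Fin n) (Fin (k + 1)) ℂ :=
  LinearMap.pi fun i => LinearMap.pi fun j => lcoeff ℂ j ∘ₗ LinearMap.proj i ∘ₗ dehomogenize

lemma coeffMatrix_apply (f : BinaryForms n k) (i : Fin n) (j : Fin (k + 1)) :
    coeffMatrix f i j = (dehomogenize f i).coeff j := rfl

lemma value_eq_mulVec (f : BinaryForms n k) (t : Fin 2 → ℂ) :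
    f.value t = coeffMatrix f *ᵥ fun j => t 0 ^ (j : ℕ) * t 1 ^ (k - j) := by
  funext i
  rw [value, ← homogenize_dehomogenize, homogenize,
    Finset.Nat.sum_antidiagonal_eq_sum_range_succ_mk, Finset.sum_range, map_sum]
  simp [MvPolynomial.eval_monomial, Finsupp.update_eq_add_single, Finsupp.prod_add_index', pow_add,
    Matrix.mulVec, dotProduct, coeffMatrix_apply]

lemma value_ne_zero_of_det_coeffMatrix_ne_zero {g : BinaryForms (k + 1) k}
    (hg : (coeffMatrix g).det ≠ 0) {t : Fin 2 → ℂ} (ht : t ≠ 0) : g.value t ≠ 0 := by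
  intro h
  rw [value_eq_mulVec] at h
  have h := congrFun (Matrix.eq_zero_of_mulVec_eq_zero hg h)
  have h0 := h (Fin.last k)
  have h1 := h 0
  simp only [Fin.val_last, tsub_self, pow_zero, mul_one, Fin.val_zero, tsub_zero, one_mul,
    Pi.zero_apply] at h0 h1
  exact ht (funext (Fin.forall_fin_two.2 ⟨eq_zero_of_pow_eq_zero h0, eq_zero_of_pow_eq_zero h1⟩))

lemma exists_det_coeffMatrix_ne_zero (k : ℕ) :
    ∃ g : BinaryForms (k + 1) k, (coeffMatrix g).det ≠ 0 := by
  refine ⟨ofPolynomials fun i => Polynomial.X ^ (i : ℕ), ?_⟩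
  suffices h : coeffMatrix (ofPolynomials (k := k) fun i => Polynomial.X ^ (i : ℕ)) = 1 by
    rw [h, det_one]
    exact one_ne_zero
  ext i j
  rw [coeffMatrix_apply, dehomogenize_ofPolynomials fun i => by simp; omega, coeff_X_pow,
    Matrix.one_apply]
  simp [Fin.ext_iff, eq_comm]

/-- The resultant of two binary forms of the same degree. -/
def resultant (f : BinaryForms 2 k) : ℂ :=
  Polynomial.resultant (dehomogenize f 0) (dehomogenize f 1) k k

lemma value_ne_zero_of_resultant_ne_zero (hk : k ≠ 0) {f : BinaryForms 2 k} (hf : f.resultant ≠ 0)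
    {t : Fin 2 → ℂ} (ht : t ≠ 0) : f.value t ≠ 0 := by
  intro h
  by_cases ht1 : t 1 = 0
  · have ht0 : t 0 ≠ 0 := fun ht0 => ht (funext (Fin.forall_fin_two.2 ⟨ht0, ht1⟩))
    have hdeg i : (dehomogenize f i).natDegree < k := by
      have hcoeff : (dehomogenize f i).coeff k = 0 := by
        have hi := congrFun h i
        rw [value_eq_mulVec, Matrix.mulVec, dotProduct, Fin.sum_univ_castSucc,
          Finset.sum_eq_zero fun j _ => by rw [ht1, Fin.val_castSucc,
            zero_pow (Nat.sub_ne_zero_of_lt j.2), mul_zero, mul_zero]] at hi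
        simpa [coeffMatrix_apply, ht0] using hi
      exact (natDegree_le_pred (natDegree_dehomogenize_le f i) hcoeff).trans_lt
        (Nat.sub_one_lt hk)
    exact hf (resultant_eq_zero_of_lt_lt _ _ _ _ (hdeg 0) (hdeg 1))
  · have hroot i : (dehomogenize f i).eval (t 0 / t 1) = 0 := by
      have hi := congrFun h i
      rw [value, ← homogenize_dehomogenize, eval_homogenize (natDegree_dehomogenize_le f i) _ ht1]
        at hi
      exact (mul_eq_zero.1 hi).resolve_right (pow_ne_zero k ht1)
    obtain ⟨p, q, -, -, hpq⟩ := exists_mul_add_mul_eq_C_resultant _ _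
      (natDegree_dehomogenize_le f 0) (natDegree_dehomogenize_le f 1) (Or.inl hk)
    have := congrArg (eval (t 0 / t 1)) hpq
    rw [eval_add, eval_mul, eval_mul, hroot, hroot, zero_mul, zero_mul, add_zero, eval_C] at this
    exact hf this.symm

lemma exists_resultant_ne_zero (k : ℕ) : ∃ f : BinaryForms 2 k, f.resultant ≠ 0 := by
  refine ⟨ofPolynomials ![Polynomial.X ^ k, 1], ?_⟩
  rw [resultant, dehomogenize_ofPolynomials (Fin.forall_fin_two.2 ⟨by simp, by simp⟩)]
  simp

end BinaryForms

/-! ### The curve of a matrix -/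

section curve

open Matrix BinaryForms

lemma exists_eq_vecMulVec_of_mulVec_eq_zero {K : Type*} [Field K] {A : Matrix (Fin 2) (Fin 2) K}
    {t : Fin 2 → K} (ht : t ≠ 0) (h : A *ᵥ t = 0) : ∃ κ, A = vecMulVec κ ![t 1, -t 0] := by
  have hA i : A i 0 * t 0 + A i 1 * t 1 = 0 := by
    rw [← Fin.sum_univ_two (f := fun j => A i j * t j)]
    exact congrFun h i
  by_cases h0 : t 0 = 0
  · have h1 : t 1 ≠ 0 := fun h1 => ht (funext (Fin.forall_fin_two.2 ⟨h0, h1⟩))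
    refine ⟨fun i => A i 0 / t 1, ext fun i j => ?_⟩
    have hA1 : A i 1 = 0 := by simpa [h0, h1] using hA i
    fin_cases j <;> simp [vecMulVec_apply, h0, h1, hA1]
  · refine ⟨fun i => -(A i 1 / t 0), ext fun i j => ?_⟩
    fin_cases j
    · simp only [Fin.zero_eta, vecMulVec_apply, cons_val_zero]
      field_simp
      linear_combination hA i
    · simp [vecMulVec_apply, h0]

variable (M : FormMatrix syzDeg genDeg)

/-- The values of the lower two rows of `M`, whose entries are linear forms on the plane. -/
def lowerRows (x : Fin 3 → ℂ) : Matrix (Fin 2) (Fin 2) ℂ := of fun i j => evalAt 0 x (M i.succ j)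

/-- The product of the row of `M` with index `i + 1` with the column `(t₀, t₁)`, as a linear form on
the plane with coefficients in `ℂ[t₀, t₁]`. -/
def rowForm (i : Fin 2) (k : Fin 3) : MvPolynomial (Fin 2) ℂ :=
  ∑ j, evalAt (0 : Fin 2 → ℂ) (Pi.single k 1) (M i.succ j) • MvPolynomial.X j

lemma isHomogeneous_rowForm (i : Fin 2) (k : Fin 3) : (rowForm M i k).IsHomogeneous 1 :=
  Submodule.sum_mem (MvPolynomial.homogeneousSubmodule (Fin 2) ℂ 1) fun j _ =>
    Submodule.smul_mem _ _ (MvPolynomial.isHomogeneous_X ℂ j)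

lemma isHomogeneous_cross_rowForm (k : Fin 3) :
    ((rowForm M 0 ⨯₃ rowForm M 1) k).IsHomogeneous 2 := by
  have h a b := (isHomogeneous_rowForm M 0 a).mul (isHomogeneous_rowForm M 1 b)
  rw [cross_apply]
  fin_cases k
  exacts [(h 1 2).sub (h 2 1), (h 2 0).sub (h 0 2), (h 0 1).sub (h 1 0)]

/-- The parametrization of the conic of `M`: the point with the parameter `t` is the common zero of
the two linear forms which are the products of the lower rows of `M` with `t`. -/
def planeForms : BinaryForms 3 2 :=
  fun k => ⟨(rowForm M 0 ⨯₃ rowForm M 1) k, isHomogeneous_cross_rowForm M k⟩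

/-- The product of the first row of `M` with `t`, at the point `v` of the line and at the point of
the conic with the parameter `t`. -/
def lineForm (v : Fin 2 → ℂ) : MvPolynomial (Fin 2) ℂ :=
  ∑ j, MvPolynomial.X j *
    evalAt (fun i => MvPolynomial.C (v i)) (fun k => (planeForms M k).1) (M 0 j : Cox)

variable {M}

lemma top_mem (j : Fin 2) : (M 0 j : Cox) ∈ Forms (1, 2) := by
  have h : genDeg 0 - syzDeg j = (1, 2) := by fin_cases j <;> rfl
  exact h ▸ (M 0 j).2

lemma lin_mem (i j : Fin 2) : (M i.succ j : Cox) ∈ Forms (0, 1) := by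
  have h : genDeg i.succ - syzDeg j = (0, 1) := by fin_cases i <;> fin_cases j <;> rfl
  exact h ▸ (M i.succ j).2

lemma isHomogeneous_lineForm (v : Fin 2 → ℂ) : (lineForm M v).IsHomogeneous 5 :=
  MvPolynomial.IsHomogeneous.sum _ _ _ fun j _ => (MvPolynomial.isHomogeneous_X ℂ j).mul (n := 4) <|
    evalAt_mem (𝒜 := MvPolynomial.homogeneousSubmodule (Fin 2) ℂ) (e := 0) (top_mem j)
      (fun i => MvPolynomial.isHomogeneous_C _ (v i)) fun k => (planeForms M k).2

variable (M) in
/-- The parametrization of the line by the solution of the equation `lineForm M v = 0` for `v`. -/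
def lineForms : BinaryForms 2 5 :=
  ![⟨-lineForm M ![0, 1], (isHomogeneous_lineForm _).neg⟩,
    ⟨lineForm M ![1, 0], isHomogeneous_lineForm _⟩]

variable (M) in
/-- The tuple of forms that parametrizes the curve of `M`: at a general point of the curve, the rank
of `M` is one, and `(t₀, t₁)` spans its kernel. -/
def curveForms : BinaryForms 2 5 × BinaryForms 3 2 := (lineForms M, planeForms M)

lemma lowerRows_mulVec (x : Fin 3 → ℂ) (t : Fin 2 → ℂ) (i : Fin 2) :
    (lowerRows M x *ᵥ t) i = (fun k => MvPolynomial.eval t (rowForm M i k)) ⬝ᵥ x := by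
  simp only [lowerRows, Matrix.mulVec, dotProduct, of_apply,
    evalAt_of_mem_zero_one (lin_mem i _) 0 x, rowForm, map_sum, MvPolynomial.smul_eval,
    MvPolynomial.eval_X, Finset.sum_mul, smul_eq_mul]
  rw [Finset.sum_comm]
  exact Finset.sum_congr rfl fun j _ => Finset.sum_congr rfl fun k _ => by ring

lemma value_planeForms (t : Fin 2 → ℂ) : (planeForms M).value t =
    (fun k => MvPolynomial.eval t (rowForm M 0 k)) ⨯₃
      fun k => MvPolynomial.eval t (rowForm M 1 k) := by
  ext k
  change MvPolynomial.eval t ((rowForm M 0 ⨯₃ rowForm M 1) k) = _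
  rw [cross_apply, cross_apply]
  fin_cases k <;> simp

lemma lowerRows_planeForms_mulVec (t : Fin 2 → ℂ) :
    lowerRows M ((planeForms M).value t) *ᵥ t = 0 := by
  ext i
  rw [lowerRows_mulVec, value_planeForms]
  fin_cases i
  exacts [dot_self_cross _ _, dot_cross_self _ _]

lemma exists_eq_smul_planeForms {t : Fin 2 → ℂ} (ht : (planeForms M).value t ≠ 0) {x : Fin 3 → ℂ}
    (h : lowerRows M x *ᵥ t = 0) : ∃ b : ℂ, x = b • (planeForms M).value t := by
  rw [value_planeForms] at ht ⊢
  exact exists_eq_smul_cross ht ((lowerRows_mulVec x t 0).symm.trans (congrFun h 0))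
    ((lowerRows_mulVec x t 1).symm.trans (congrFun h 1))

lemma eval_lineForm (v t : Fin 2 → ℂ) : MvPolynomial.eval t (lineForm M v) =
    ∑ j, evalAt v ((planeForms M).value t) (M 0 j) * t j := by
  simp only [lineForm, map_sum, map_mul, MvPolynomial.eval_X, ← MvPolynomial.aeval_eq_eval]
  refine Finset.sum_congr rfl fun j _ => ?_
  rw [mul_comm, map_evalAt, MvPolynomial.aeval_eq_eval,
    show MvPolynomial.eval t ∘ (fun i => MvPolynomial.C (v i)) = v by ext; simp]
  rfl

lemma value_lineForms (t : Fin 2 → ℂ) : (lineForms M).value t =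
    ![-MvPolynomial.eval t (lineForm M ![0, 1]), MvPolynomial.eval t (lineForm M ![1, 0])] :=
  funext (Fin.forall_fin_two.2 ⟨map_neg _ _, rfl⟩)

lemma sum_evalAt_top (s t : Fin 2 → ℂ) :
    ∑ j, evalAt s ((planeForms M).value t) (M 0 j) * t j =
      s 0 * (lineForms M).value t 1 - s 1 * (lineForms M).value t 0 := by
  simp only [value_lineForms, cons_val_zero, cons_val_one, eval_lineForm, Fin.sum_univ_two,
    evalAt_of_mem_one (top_mem _) s]
  ring

end curve

/-! ### The equations of the curve -/

section irreducible

variable {σ K : Type*} [Field K]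

lemma irreducible_of_map_eq_zero {B : Type*} [CommRing B] [IsDomain B]
    (φ : MvPolynomial σ K →+* B) {F : MvPolynomial σ K} (h0 : F ≠ 0) (hF : φ F = 0)
    (hdeg : F.totalDegree ≤ 2) (hφ : ∀ A, A.totalDegree ≤ 1 → φ A = 0 → A = 0) :
    Irreducible F := by
  refine ⟨fun hu => (hu.map φ).ne_zero hF, fun A B hAB => ?_⟩
  subst hAB
  have hA := left_ne_zero_of_mul h0
  have hB := right_ne_zero_of_mul h0
  rw [MvPolynomial.totalDegree_mul_of_isDomain hA hB] at hdeg
  have isUnit {E : MvPolynomial σ K} (hE : E ≠ 0) (hE0 : E.totalDegree = 0) : IsUnit E := by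
    rw [MvPolynomial.totalDegree_eq_zero_iff_eq_C.1 hE0, MvPolynomial.C_ne_zero] at hE
    rw [MvPolynomial.totalDegree_eq_zero_iff_eq_C.1 hE0]
    exact (isUnit_iff_ne_zero.2 hE).map MvPolynomial.C
  rw [map_mul, mul_eq_zero] at hF
  rcases hF with h | h
  · have : ¬ A.totalDegree ≤ 1 := fun h1 => hA (hφ A h1 h)
    exact .inr (isUnit hB (by omega))
  · have : ¬ B.totalDegree ≤ 1 := fun h1 => hB (hφ B h1 h)
    exact .inl (isUnit hA (by omega))

lemma eval_eq_of_totalDegree_le_one [Fintype σ] {A : MvPolynomial σ K} (hA : A.totalDegree ≤ 1)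
    (v : σ → K) :
    MvPolynomial.eval v A = A.coeff 0 + ∑ i, A.coeff (Finsupp.single i 1) * v i := by
  classical
  have hsub : A.support ⊆ insert 0 (Finset.univ.image fun i => Finsupp.single i 1) := fun μ hμ => by
    have h1 : μ.degree ≤ 1 := (MvPolynomial.le_totalDegree hμ).trans hA
    obtain h | h : μ.degree = 0 ∨ μ.degree = 1 := by omega
    · simp [(Finsupp.degree_eq_zero_iff μ).1 h]
    · obtain ⟨i, rfl⟩ := (Finsupp.sum_eq_one_iff μ).1 h
      simp
  rw [MvPolynomial.eval_eq', Finset.sum_subset hsub fun μ _ hμ => by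
    rw [MvPolynomial.notMem_support_iff.1 hμ, zero_mul], Finset.sum_insert (by simp),
    Finset.sum_image fun i _ j _ h => Finsupp.single_left_injective one_ne_zero h]
  simp [Finsupp.single_apply, Finset.prod_ite_eq]

end irreducible

section conic

open Matrix BinaryForms

variable (M : FormMatrix syzDeg genDeg)

/-- The determinant of the lower two rows of `M`. -/
def conic : Cox := M 1 0 * M 2 1 - M 2 0 * M 1 1

/-- The maximal minor of `M` formed by the row with index `i + 1` and the first row. -/
def minor (i : Fin 2) : Cox := M i.succ 0 * M 0 1 - M 0 0 * M i.succ 1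

/-- The zero `w` of the minor with index `i`, a linear form in the coordinates of the line: the
minor is equal to `s₀ w₁ - s₁ w₀`. -/
def minorZero (i : Fin 2) : Fin 2 → Cox :=
  ![-evalAt ![0, 1] (fun k => MvPolynomial.X (.inr k)) (minor M i),
    evalAt ![1, 0] (fun k => MvPolynomial.X (.inr k)) (minor M i)]

variable {M}

lemma conic_mem : conic M ∈ Forms (0, 2) :=
  sub_mem (mul_mem (lin_mem 0 0) (lin_mem 1 1)) (mul_mem (lin_mem 1 0) (lin_mem 0 1))

lemma minor_mem (i : Fin 2) : minor M i ∈ Forms (1, 3) :=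
  sub_mem (mul_mem (lin_mem i 0) (top_mem 1)) (mul_mem (top_mem 0) (lin_mem i 1))

lemma evalAt_conic (s : Fin 2 → ℂ) (x : Fin 3 → ℂ) :
    evalAt s x (conic M) = (lowerRows M x).det := by
  rw [det_fin_two, evalAt_congr_fst conic_mem s 0, conic, map_sub, map_mul, map_mul]
  exact congrArg _ (mul_comm _ _)

lemma evalAt_planeForms_conic (s t : Fin 2 → ℂ) :
    evalAt s ((planeForms M).value t) (conic M) = 0 := by
  by_cases ht : t = 0
  · have h := evalAt_smul (conic_mem (M := M)) 1 0 s 0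
    rw [zero_smul, one_smul] at h
    rw [ht, value_zero two_ne_zero, h]
    simp
  · rw [evalAt_conic]
    exact exists_mulVec_eq_zero_iff.1 ⟨t, ht, lowerRows_planeForms_mulVec t⟩

lemma evalAt_minor {s t κ : Fin 2 → ℂ} {b : ℂ} (i : Fin 2)
    (h : lowerRows M (b • (planeForms M).value t) = vecMulVec κ ![t 1, -t 0]) :
    evalAt s (b • (planeForms M).value t) (minor M i) =
      b ^ 2 * κ i * (s 0 * (lineForms M).value t 1 - s 1 * (lineForms M).value t 0) := by
  have hlow (j : Fin 2) : evalAt s (b • (planeForms M).value t) (M i.succ j) =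
      κ i * ![t 1, -t 0] j := by
    rw [evalAt_congr_fst (lin_mem i j) s 0]
    exact congrFun (congrFun h i) j
  have htop (j : Fin 2) : evalAt s (b • (planeForms M).value t) (M 0 j) =
      b ^ 2 * evalAt s ((planeForms M).value t) (M 0 j) := by
    simpa using evalAt_smul (top_mem (M := M) j) 1 b s ((planeForms M).value t)
  rw [minor, map_sub, map_mul, map_mul, hlow, hlow, htop, htop, ← sum_evalAt_top, Fin.sum_univ_two]
  simp only [cons_val]
  ring

lemma evalAt_planeForms_minor {t : Fin 2 → ℂ} (ht : t ≠ 0) (i : Fin 2) :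
    evalAt ((lineForms M).value t) ((planeForms M).value t) (minor M i) = 0 := by
  obtain ⟨κ, hκ⟩ :=
    exists_eq_vecMulVec_of_mulVec_eq_zero ht (lowerRows_planeForms_mulVec (M := M) t)
  rw [← one_smul ℂ ((planeForms M).value t)] at hκ ⊢
  rw [evalAt_minor i hκ, mul_comm (value _ _ 0), sub_self, mul_zero]

lemma minorZero_mem (i j : Fin 2) : minorZero M i j ∈ Forms (0, 3) := by
  have mem {s : Fin 2 → Cox} (hs : ∀ j, s j ∈ Forms 0) :
      evalAt s (fun k => MvPolynomial.X (.inr k)) (minor M i) ∈ Forms (0, 3) := by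
    have h := evalAt_mem (𝒜 := fun d => Forms d) (minor_mem (M := M) i) hs
      fun k => MvPolynomial.isWeightedHomogeneous_X ℂ bideg (.inr k)
    exact h
  have h1 : (1 : Cox) ∈ Forms 0 := MvPolynomial.isWeightedHomogeneous_one ℂ bideg
  fin_cases j
  · exact neg_mem (mem (Fin.forall_fin_two.2 ⟨zero_mem _, h1⟩))
  · exact mem (Fin.forall_fin_two.2 ⟨h1, zero_mem _⟩)

lemma minor_eq (i : Fin 2) : minor M i =
    MvPolynomial.X (.inl 0) * minorZero M i 1 - MvPolynomial.X (.inl 1) * minorZero M i 0 := by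
  conv_lhs => rw [← evalAt_X (minor M i), evalAt_of_mem_one (minor_mem i)]
  simp [minorZero]

lemma evalAt_minorZero {s t κ : Fin 2 → ℂ} {b : ℂ} (i : Fin 2)
    (h : lowerRows M (b • (planeForms M).value t) = vecMulVec κ ![t 1, -t 0]) :
    evalAt s (b • (planeForms M).value t) ∘ minorZero M i =
      (b ^ 2 * κ i) • (lineForms M).value t := by
  have eval_coeff (v : Fin 2 → Cox) : evalAt s (b • (planeForms M).value t)
      (evalAt v (fun k => MvPolynomial.X (.inr k)) (minor M i)) =
      evalAt (evalAt s (b • (planeForms M).value t) ∘ v) (b • (planeForms M).value t)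
        (minor M i) := by
    rw [map_evalAt]
    congr 2
    ext k
    simp
  ext j
  fin_cases j <;> simp [minorZero, eval_coeff, evalAt_minor i h]

lemma minor_dvd (i j k : Fin 2) : minor M i ∣
    minorZero M i j * MvPolynomial.X (.inl k) - MvPolynomial.X (.inl j) * minorZero M i k := by
  have h := minor_eq (M := M) i
  obtain rfl | h0 := eq_or_ne j k
  · exact ⟨0, by ring⟩
  · obtain ⟨rfl, rfl⟩ | ⟨rfl, rfl⟩ : j = 0 ∧ k = 1 ∨ j = 1 ∧ k = 0 := by omega
    · exact ⟨-1, by rw [h]; ring⟩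
    · exact ⟨1, by rw [h]; ring⟩

section nondegenerate

variable (hM : (coeffMatrix (planeForms M)).det ≠ 0)

include hM

lemma exists_param {x : Fin 3 → ℂ} (hx : (lowerRows M x).det = 0) :
    ∃ (t : Fin 2 → ℂ) (b : ℂ) (κ : Fin 2 → ℂ), t ≠ 0 ∧ x = b • (planeForms M).value t ∧
      lowerRows M x = vecMulVec κ ![t 1, -t 0] := by
  obtain ⟨t, ht, h⟩ := exists_mulVec_eq_zero_iff.2 hx
  obtain ⟨b, hb⟩ :=
    exists_eq_smul_planeForms (value_ne_zero_of_det_coeffMatrix_ne_zero hM ht) h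
  obtain ⟨κ, hκ⟩ := exists_eq_vecMulVec_of_mulVec_eq_zero ht h
  exact ⟨t, b, κ, ht, hb, hκ⟩

lemma eq_zero_of_lowerRows_eq_zero {x : Fin 3 → ℂ} (hx : lowerRows M x = 0) : x = 0 := by
  have exists_smul {t : Fin 2 → ℂ} (ht : t ≠ 0) : ∃ b : ℂ, x = b • (planeForms M).value t :=
    exists_eq_smul_planeForms (value_ne_zero_of_det_coeffMatrix_ne_zero hM ht)
      (by rw [hx, zero_mulVec])
  obtain ⟨a, ha⟩ := exists_smul (t := ![1, 0]) (by simp)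
  obtain ⟨b, hb⟩ := exists_smul (t := ![0, 1]) (by simp)
  have hab := ha.symm.trans hb
  simp only [value_eq_mulVec, ← mulVec_smul] at hab
  have hb0 : 0 = b := by simpa using congrFun (mulVec_injective_of_det_ne_zero hM hab) 0
  rw [hb, ← hb0, zero_smul]

lemma conic_ne_zero : conic M ≠ 0 := by
  intro h
  obtain ⟨t, b, -, -, hb, -⟩ := exists_param hM
    (x := (planeForms M).value ![1, 0] + (planeForms M).value ![0, 1])
    (by rw [← evalAt_conic 0, h, map_zero])
  simp only [value_eq_mulVec, ← mulVec_smul, ← mulVec_add] at hb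
  have hφ := congrFun (mulVec_injective_of_det_ne_zero hM hb)
  have h0 : 1 = b * t 1 ^ 2 := by simpa using hφ 0
  have h1 : 0 = b * (t 0 * t 1) := by simpa using hφ 1
  have h2 : 1 = b * t 0 ^ 2 := by simpa using hφ 2
  exact one_ne_zero (α := ℂ) (by linear_combination h0 + b * t 1 ^ 2 * h2 - b * (t 0 * t 1) * h1)

lemma eq_zero_of_dotProduct_planeForms_eq_zero {β : Fin 3 → ℂ}
    (hβ : ∀ t, β ⬝ᵥ (planeForms M).value t = 0) : β = 0 := by
  refine eq_zero_of_vecMul_eq_zero hM ?_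
  simp only [value_eq_mulVec, dotProduct_mulVec] at hβ
  have h0 : (β ᵥ* coeffMatrix (planeForms M)) 0 = 0 := by
    simpa [dotProduct, Fin.sum_univ_three] using hβ ![0, 1]
  have h2 : (β ᵥ* coeffMatrix (planeForms M)) 2 = 0 := by
    simpa [dotProduct, Fin.sum_univ_three] using hβ ![1, 0]
  have h1 : (β ᵥ* coeffMatrix (planeForms M)) 1 = 0 := by
    simpa [dotProduct, Fin.sum_univ_three, h0, h2] using hβ ![1, 1]
  ext i
  fin_cases i
  exacts [h0, h1, h2]

end nondegenerate

end conic

/-! ### The ideal of the curve -/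

section resolution

open Matrix BinaryForms

variable {M : FormMatrix syzDeg genDeg}

section nondegenerate

variable (hM : (coeffMatrix (planeForms M)).det ≠ 0)

include hM

lemma eq_zero_of_totalDegree_le_one {A : Cox} (hA : A.totalDegree ≤ 1)
    (h : ∀ s t, evalAt s ((planeForms M).value t) A = 0) : A = 0 := by
  have eval (s : Fin 2 → ℂ) (x : Fin 3 → ℂ) : evalAt s x A = A.coeff 0 +
      (∑ i, A.coeff (Finsupp.single (.inl i) 1) * s i +
        ∑ k, A.coeff (Finsupp.single (.inr k) 1) * x k) := by
    rw [evalAt, MvPolynomial.aeval_eq_eval, eval_eq_of_totalDegree_le_one hA,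
      Fintype.sum_sum_type]
    rfl
  simp only [eval] at h
  have h0 : A.coeff 0 = 0 := by simpa [value_zero] using h 0 0
  have hα i : A.coeff (Finsupp.single (.inl i) 1) = 0 := by
    simpa [value_zero, h0, Pi.single_apply] using h (Pi.single i 1) 0
  have hβ := eq_zero_of_dotProduct_planeForms_eq_zero hM
    (β := fun k => A.coeff (Finsupp.single (.inr k) 1))
    fun t => by simpa [h0, dotProduct] using h 0 t
  refine MvPolynomial.funext fun v => ?_
  rw [eval_eq_of_totalDegree_le_one hA, Fintype.sum_sum_type]
  simp [h0, hα, funext_iff.1 hβ]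

lemma prime_conic : Prime (conic M) := by
  let φ := evalAt (A := MvPolynomial (Fin 2 ⊕ Fin 2) ℂ) (fun i => MvPolynomial.X (.inl i))
    fun k => MvPolynomial.rename Sum.inr (planeForms M k).1
  have eval_φ (F : Cox) (s t : Fin 2 → ℂ) : MvPolynomial.aeval (Sum.elim s t) (φ F) =
      evalAt s ((planeForms M).value t) F := by
    rw [map_evalAt]
    congr 2
    · ext i
      simp
    · ext k
      simp [value, MvPolynomial.eval_rename]
  refine (irreducible_of_map_eq_zero φ.toRingHom (conic_ne_zero hM) ?_ ?_ ?_).prime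
  · refine MvPolynomial.funext fun v => ?_
    rw [map_zero, ← evalAt_planeForms_conic (M := M) (v ∘ .inl) (v ∘ .inr), ← eval_φ]
    simp [MvPolynomial.aeval_eq_eval]
  · have := totalDegree_le_of_mem (conic_mem (M := M))
    simpa using this
  · intro A hA h
    refine eq_zero_of_totalDegree_le_one hM hA fun s t => ?_
    rw [← eval_φ, show φ A = 0 from h, map_zero]

lemma conic_dvd {T : Cox} (hT : ∀ s x, evalAt s x (conic M) = 0 → evalAt s x T = (0 : ℂ)) :
    conic M ∣ T := by
  have hp := prime_conic hM
  rw [← Ideal.mem_span_singleton,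
    ← ((Ideal.span_singleton_prime hp.ne_zero).2 hp).isRadical.radical,
    ← MvPolynomial.vanishingIdeal_zeroLocus_eq_radical (K := ℂ)]
  intro v hv
  rw [← Sum.elim_comp_inl_inr v] at hv ⊢
  exact hT _ _ (hv _ (Ideal.mem_span_singleton_self _))

lemma conic_dvd_evalAt_minorZero {δ : ℤ × ℤ} {P : Cox} (hP : P ∈ Forms δ)
    (h : ∀ t ≠ 0, evalAt ((lineForms M).value t) ((planeForms M).value t) P = 0) (i : Fin 2) :
    conic M ∣ evalAt (minorZero M i) (fun k => MvPolynomial.X (.inr k)) P := by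
  refine conic_dvd hM fun s x hx => ?_
  obtain ⟨t, b, κ, ht, rfl, hκ⟩ := exists_param hM (evalAt_conic s x ▸ hx)
  rw [map_evalAt, evalAt_minorZero i hκ,
    show ⇑(evalAt s _) ∘ (fun k => MvPolynomial.X (.inr k)) = b • (planeForms M).value t by
      ext k
      simp,
    evalAt_smul hP, h t ht, mul_zero]

lemma exists_not_conic_dvd_minor (hf : ∀ t ≠ 0, (lineForms M).value t ≠ 0) :
    ∃ i, ¬ conic M ∣ minor M i := by
  have ht : (![1, 0] : Fin 2 → ℂ) ≠ 0 := by simp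
  obtain ⟨κ, hκ⟩ :=
    exists_eq_vecMulVec_of_mulVec_eq_zero ht (lowerRows_planeForms_mulVec (M := M) _)
  have hκ0 : κ ≠ 0 := by
    rintro rfl
    exact value_ne_zero_of_det_coeffMatrix_ne_zero hM ht
      (eq_zero_of_lowerRows_eq_zero hM (hκ.trans (zero_vecMulVec _)))
  obtain ⟨i, hi⟩ := Function.ne_iff.1 hκ0
  refine ⟨i, fun ⟨q, hq⟩ => ?_⟩
  rw [← one_smul ℂ ((planeForms M).value ![1, 0])] at hκ
  have vanish (s : Fin 2 → ℂ) :
      s 0 * (lineForms M).value ![1, 0] 1 - s 1 * (lineForms M).value ![1, 0] 0 = 0 := by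
    have h := evalAt_minor (s := s) i hκ
    rw [one_smul, hq, map_mul, evalAt_planeForms_conic, zero_mul, one_pow, one_mul] at h
    exact (mul_eq_zero.1 h.symm).resolve_left hi
  refine hf _ ht (funext (Fin.forall_fin_two.2 ⟨?_, ?_⟩))
  · simpa using vanish ![0, 1]
  · simpa using vanish ![1, 0]

end nondegenerate

lemma minor_dvd_pow_mul_sub {δ : ℤ × ℤ} {P : Cox} (hP : P ∈ Forms δ) (i j : Fin 2) :
    minor M i ∣ minorZero M i j ^ δ.1.toNat * P - MvPolynomial.X (.inl j) ^ δ.1.toNat *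
      evalAt (minorZero M i) (fun k => MvPolynomial.X (.inr k)) P := by
  have evalAt_smul_fst (a : Cox) (s : Fin 2 → Cox) (x : Fin 3 → Cox) :
      evalAt (a • s) x P = a ^ δ.1.toNat * evalAt s x P := by
    simpa using evalAt_smul hP a 1 s x
  have h := dvd_evalAt_sub_evalAt (s := minorZero M i j • fun k => MvPolynomial.X (.inl k))
    (s' := (MvPolynomial.X (.inl j) : Cox) • minorZero M i)
    (fun k => by simpa only [Pi.smul_apply, smul_eq_mul] using minor_dvd i j k)
    (fun k => MvPolynomial.X (.inr k)) P
  rwa [evalAt_smul_fst, evalAt_smul_fst, evalAt_X] at h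

variable (M) in
/-- The maximal minors of `M`, with the signs that make them a row which is annihilated by `M`. -/
def equations : (i : Fin 3) → Forms (0 - genDeg i) := fun i =>
  ⟨![conic M, minor M 1, -minor M 0] i, by
    fin_cases i
    exacts [conic_mem, minor_mem 1, neg_mem (minor_mem 0)]⟩

lemma minors_polyMatrix : minors (polyMatrix M) = fun i => (equations M i : Cox) := by
  rw [minors, cross_apply]
  ext1 i
  fin_cases i <;> simp [polyMatrix, equations, conic, minor]

lemma evalAt_planeForms_equations {t : Fin 2 → ℂ} (ht : t ≠ 0) (i : Fin 3) :
    evalAt ((lineForms M).value t) ((planeForms M).value t) (equations M i) = 0 := by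
  fin_cases i
  · exact evalAt_planeForms_conic _ t
  · exact evalAt_planeForms_minor ht 1
  · exact (map_neg _ _).trans (neg_eq_zero.2 (evalAt_planeForms_minor ht 0))

lemma mem_span_equations {i : Fin 2} {a F : Cox} (ha : conic M ∣ a) (hF : minor M i ∣ F - a) :
    F ∈ Ideal.span (Set.range fun i => (equations M i : Cox)) := by
  have mem (k : Fin 3) {b : Cox} (h : (equations M k : Cox) ∣ b) :
      b ∈ Ideal.span (Set.range fun i => (equations M i : Cox)) :=
    Ideal.mem_of_dvd _ h (Ideal.subset_span ⟨k, rfl⟩)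
  rw [← sub_add_cancel F a]
  refine add_mem ?_ (mem 0 ha)
  fin_cases i
  exacts [mem 2 (neg_dvd.2 hF), mem 1 hF]

lemma exists_eq_mulVec_of_equations_dotProduct_eq_zero
    (hM : (coeffMatrix (planeForms M)).det ≠ 0) (hf : ∀ t ≠ 0, (lineForms M).value t ≠ 0)
    {F : Fin 3 → Cox} (hF : (fun i => (equations M i : Cox)) ⬝ᵥ F = 0) :
    ∃ u, F = polyMatrix M *ᵥ u := by
  rw [← minors_polyMatrix] at hF
  obtain ⟨i, hi⟩ := exists_not_conic_dvd_minor hM hf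
  have h0 : minors (polyMatrix M) 0 = conic M := congrFun minors_polyMatrix 0
  obtain ⟨k, hk⟩ : ∃ k, ¬ conic M ∣ minors (polyMatrix M) k := by
    rw [minors_polyMatrix]
    fin_cases i
    exacts [⟨2, fun h => hi (dvd_neg.1 h)⟩, ⟨1, hi⟩]
  exact exists_eq_mulVec_of_minors_dotProduct_eq_zero (h0 ▸ prime_conic hM) (h0 ▸ hk) hF

variable {c : RationalCurve 5 2} (hc : c.forms = curveForms M)

include hc

lemma val_equations_eq_zero (i : Fin 3) {y : Coord} (hy : proj y ∈ c.carrier) :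
    val (equations M i) y = 0 := by
  obtain ⟨t, ht, h⟩ := hy
  by_contra hne
  refine val_ne_zero_of_proj_eq _ h.symm hne ?_
  rw [val_eq_evalAt]
  simpa only [hc, curveForms] using evalAt_planeForms_equations ht i

lemma evalAt_eq_zero_of_vanishing {P : Cox} (hP : ∀ y, proj y ∈ c.carrier → val P y = 0)
    {t : Fin 2 → ℂ} (ht : t ≠ 0) :
    evalAt ((lineForms M).value t) ((planeForms M).value t) P = 0 := by
  have h := hP _ ⟨t, ht, rfl⟩
  rw [val_eq_evalAt] at h
  simpa only [hc, curveForms] using h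

lemma lineForms_value_ne_zero {t : Fin 2 → ℂ} (ht : t ≠ 0) : (lineForms M).value t ≠ 0 := by
  simpa only [hc, curveForms] using c.fst_ne t ht

variable (hM : (coeffMatrix (planeForms M)).det ≠ 0)

include hM

-- Off the conic `D = conic M` works. At a point of the conic, one of the `minorZero M i j` does not
-- vanish, and a power of it works: modulo `minor M i`, the form `P` becomes, after multiplication
-- by such a power, a multiple of the form obtained by the substitution of `minorZero M i` for the
-- coordinates of the line, and `conic M` divides the latter.
lemma generatesLocally_equations :
    GeneratesLocally (fun i => (equations M i : Cox)) c.carrier := by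
  intro δ P hP y
  by_cases hy : val (conic M) y = 0
  · rw [val_eq_evalAt, evalAt_conic] at hy
    obtain ⟨t, b, κ, ht, hx, hκ⟩ := exists_param hM hy
    obtain ⟨j, hj⟩ := Function.ne_iff.1 (lineForms_value_ne_zero hc ht)
    obtain ⟨i, hi⟩ : ∃ i, κ i ≠ 0 := Function.ne_iff.1 fun hκ0 =>
      y.2.2 (eq_zero_of_lowerRows_eq_zero hM (by rw [hκ, hκ0]; exact zero_vecMulVec _))
    have hb : b ≠ 0 := fun hb => y.2.2 (by rw [hx, hb, zero_smul])
    have hw : val (minorZero M i j) y ≠ 0 := by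
      rw [val_eq_evalAt, hx]
      rw [hx] at hκ
      exact (congrFun (evalAt_minorZero i hκ) j).trans_ne
        (mul_ne_zero (mul_ne_zero (pow_ne_zero 2 hb) hi) hj)
    refine ⟨_, ⟨_, (minorZero_mem i j).pow δ.1.toNat⟩, ?_,
      mem_span_equations (dvd_mul_of_dvd_right (conic_dvd_evalAt_minorZero hM P.2
        (fun t ht => evalAt_eq_zero_of_vanishing hc hP ht) i) _) (minor_dvd_pow_mul_sub P.2 i j)⟩
    rw [val_eq_evalAt] at hw ⊢
    rw [map_pow]
    exact pow_ne_zero _ hw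
  · exact ⟨_, ⟨_, conic_mem⟩, hy, Ideal.mul_mem_right _ _ (Ideal.subset_span ⟨0, rfl⟩)⟩

theorem resolves : Resolves M c.carrier := by
  have minors_ne_zero : minors (polyMatrix M) ≠ 0 := fun h =>
    conic_ne_zero hM ((congrFun minors_polyMatrix 0).symm.trans (congrFun h 0))
  exact resolves_of_exact (R := equations M) (fun i y => val_equations_eq_zero hc i)
    (minors_polyMatrix (M := M) ▸ minors_vecMul)
    (fun u => eq_zero_of_mulVec_eq_zero_of_minors_ne_zero minors_ne_zero)
    (fun F => exists_eq_mulVec_of_equations_dotProduct_eq_zero hM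
      fun t ht => lineForms_value_ne_zero hc ht)
    (generatesLocally_equations hc hM)

end resolution

/-! ### Polynomial maps and the Zariski topology -/

section polyFunctions

open BinaryForms

variable {V W W' : Type} [AddCommGroup V] [Module ℂ V] [AddCommGroup W] [Module ℂ W]
  [AddCommGroup W'] [Module ℂ W']

lemma dual_mem_polyFunctions (l : Module.Dual ℂ V) : (fun v => l v) ∈ polyFunctions V :=
  Algebra.subset_adjoin ⟨l, rfl⟩

lemma sum_mem_polyFunctions {ι : Type*} {s : Finset ι} {p : ι → V → ℂ}
    (hp : ∀ i ∈ s, p i ∈ polyFunctions V) : (fun v => ∑ i ∈ s, p i v) ∈ polyFunctions V := by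
  rw [← Finset.sum_fn]
  exact sum_mem hp

lemma det_mem_polyFunctions {ι : Type*} [Fintype ι] [DecidableEq ι] {A : V → Matrix ι ι ℂ}
    (hA : ∀ i j, (fun v => A v i j) ∈ polyFunctions V) :
    (fun v => (A v).det) ∈ polyFunctions V := by
  let B : Matrix ι ι (polyFunctions V) := Matrix.of fun i j => ⟨_, hA i j⟩
  have hB : (fun v => (A v).det) = B.det := funext fun v =>
    (((Pi.evalAlgHom ℂ _ v).comp (polyFunctions V).val).map_det B).symm
  exact hB ▸ B.det.2

lemma eval_mem_polyFunctions {σ : Type*} [Finite σ] {F : V → MvPolynomial σ ℂ}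
    (hF : ∀ μ, (fun v => (F v).coeff μ) ∈ polyFunctions V) {n : ℕ}
    (hn : ∀ v, (F v).totalDegree ≤ n) {x : V → σ → ℂ}
    (hx : ∀ i, (fun v => x v i) ∈ polyFunctions V) :
    (fun v => MvPolynomial.eval (x v) (F v)) ∈ polyFunctions V := by
  cases nonempty_fintype σ
  have h v : MvPolynomial.eval (x v) (F v) =
      ∑ μ ∈ (Finsupp.finite_of_degree_le n).toFinset, (F v).coeff μ * ∏ i, x v i ^ μ i := by
    rw [MvPolynomial.eval_eq']
    refine Finset.sum_subset (fun μ hμ => ?_) fun μ _ hμ => ?_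
    · exact (Set.Finite.mem_toFinset _).2 ((MvPolynomial.le_totalDegree hμ).trans (hn v))
    · rw [MvPolynomial.notMem_support_iff.1 hμ, zero_mul]
  simp only [h]
  refine sum_mem_polyFunctions fun μ _ => (polyFunctions V).mul_mem (hF μ) ?_
  rw [← Finset.prod_fn]
  exact prod_mem fun i _ => pow_mem (hx i) _

lemma exists_polynomial_line {p : V → ℂ} (hp : p ∈ polyFunctions V) (v w : V) :
    ∃ P : Polynomial ℂ, ∀ z : ℂ, p (v + z • w) = P.eval z := by
  induction hp using Algebra.adjoin_induction with
  | mem p hp =>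
    obtain ⟨l, rfl⟩ := hp
    exact ⟨Polynomial.C (l v) + Polynomial.X * Polynomial.C (l w), fun z => by simp [mul_comm z]⟩
  | algebraMap a => exact ⟨Polynomial.C a, fun z => by simp⟩
  | add p q _ _ hp hq =>
    obtain ⟨P, hP⟩ := hp
    obtain ⟨Q, hQ⟩ := hq
    exact ⟨P + Q, fun z => by simp [hP, hQ]⟩
  | mul p q _ _ hp hq =>
    obtain ⟨P, hP⟩ := hp
    obtain ⟨Q, hQ⟩ := hq
    exact ⟨P * Q, fun z => by simp [hP, hQ]⟩

lemma exists_ne_zero_and_ne_zero {p q : V → ℂ} (hp : p ∈ polyFunctions V) (hq : q ∈ polyFunctions V)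
    {v w : V} (hv : p v ≠ 0) (hw : q w ≠ 0) : ∃ u, p u ≠ 0 ∧ q u ≠ 0 := by
  obtain ⟨P, hP⟩ := exists_polynomial_line hp v (w - v)
  obtain ⟨Q, hQ⟩ := exists_polynomial_line hq v (w - v)
  have hP0 : P ≠ 0 := by
    rintro rfl
    exact hv (by simpa using hP 0)
  have hQ0 : Q ≠ 0 := by
    rintro rfl
    exact hw (by simpa using hQ 1)
  obtain ⟨z, hz⟩ := (P * Q).exists_eval_ne_zero_of_natDegree_lt_card (mul_ne_zero hP0 hQ0)
    (Cardinal.natCast_lt_aleph0.trans_le (Cardinal.aleph0_le_mk ℂ))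
  rw [Polynomial.eval_mul, ← hP, ← hQ] at hz
  exact ⟨_, left_ne_zero_of_mul hz, right_ne_zero_of_mul hz⟩

lemma isOpen_ne_zero {p : V → ℂ} (hp : p ∈ polyFunctions V) : IsOpen[zariski V] {v | p v ≠ 0} :=
  .basic _ ⟨p, hp, rfl⟩

lemma isTopologicalBasis_zariski :
    @IsTopologicalBasis V (zariski V) {U | ∃ p ∈ polyFunctions V, U = {v | p v ≠ 0}} := by
  let := zariski V
  refine isTopologicalBasis_of_subbasis_of_finiteInter rfl ⟨⟨1, one_mem _, ?_⟩, ?_⟩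
  · simp
  · rintro _ ⟨p, hp, rfl⟩ _ ⟨q, hq, rfl⟩
    exact ⟨p * q, (polyFunctions V).mul_mem hp hq, by ext; simp⟩

lemma nonempty_inter_of_isOpen_zariski {O O' : Set V} (hO : IsOpen[zariski V] O)
    (hO' : IsOpen[zariski V] O') (h : O.Nonempty) (h' : O'.Nonempty) : (O ∩ O').Nonempty := by
  let := zariski V
  obtain ⟨v, hv⟩ := h
  obtain ⟨w, hw⟩ := h'
  obtain ⟨_, ⟨p, hp, rfl⟩, hpv, hpO⟩ := isTopologicalBasis_zariski.exists_subset_of_mem_open hv hO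
  obtain ⟨_, ⟨q, hq, rfl⟩, hqw, hqO⟩ := isTopologicalBasis_zariski.exists_subset_of_mem_open hw hO'
  obtain ⟨u, hpu, hqu⟩ := exists_ne_zero_and_ne_zero hp hq hpv hqw
  exact ⟨u, hpO hpu, hqO hqu⟩

/-- Polynomial maps between vector spaces, which are the maps with polynomial coordinates. -/
def IsPolynomialMap (Ψ : V → W) : Prop :=
  ∀ l : Module.Dual ℂ W, (fun v => l (Ψ v)) ∈ polyFunctions V

lemma isPolynomialMap_of_separating [FiniteDimensional ℂ W] {ι : Type*} {φ : ι → Module.Dual ℂ W}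
    (hφ : ∀ w, (∀ i, φ i w = 0) → w = 0) {Ψ : V → W}
    (h : ∀ i, (fun v => φ i (Ψ v)) ∈ polyFunctions V) : IsPolynomialMap Ψ := by
  have hspan : Submodule.span ℂ (Set.range φ) = ⊤ := by
    rw [← Subspace.dualCoannihilator_dualAnnihilator_eq (W := Submodule.span ℂ (Set.range φ)),
      (Submodule.eq_bot_iff _).2 fun w hw => hφ w fun i =>
        (Submodule.mem_dualCoannihilator w).1 hw _ (Submodule.subset_span (Set.mem_range_self i)),
      Submodule.dualAnnihilator_bot]
  intro l
  have hl : l ∈ Submodule.span ℂ (Set.range φ) := hspan ▸ Submodule.mem_top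
  induction hl using Submodule.span_induction with
  | mem l hl =>
    obtain ⟨i, rfl⟩ := hl
    exact h i
  | zero => exact zero_mem (polyFunctions V)
  | add l l' _ _ hl hl' => exact add_mem hl hl'
  | smul a l _ hl => exact (polyFunctions V).smul_mem hl a

lemma isPolynomialMap_linearMap (φ : V →ₗ[ℂ] W) : IsPolynomialMap φ := fun l =>
  dual_mem_polyFunctions (l ∘ₗ φ)

namespace IsPolynomialMap

lemma prodMk {Ψ : V → W} {Ψ' : V → W'} (hΨ : IsPolynomialMap Ψ) (hΨ' : IsPolynomialMap Ψ') :
    IsPolynomialMap fun v => (Ψ v, Ψ' v) := fun l => by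
  have h v : l (Ψ v, Ψ' v) = l.comp (.inl ℂ W W') (Ψ v) + l.comp (.inr ℂ W W') (Ψ' v) := by
    simp [← map_add]
  simp only [h]
  exact add_mem (hΨ _) (hΨ' _)

lemma comp_mem {Ψ : V → W} (hΨ : IsPolynomialMap Ψ) {p : W → ℂ} (hp : p ∈ polyFunctions W) :
    (fun v => p (Ψ v)) ∈ polyFunctions V := by
  induction hp using Algebra.adjoin_induction with
  | mem p hp =>
    obtain ⟨l, rfl⟩ := hp
    exact hΨ l
  | algebraMap a => exact (polyFunctions V).algebraMap_mem a
  | add p q _ _ hp hq => exact add_mem hp hq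
  | mul p q _ _ hp hq => exact (polyFunctions V).mul_mem hp hq

lemma isOpen_preimage {Ψ : V → W} (hΨ : IsPolynomialMap Ψ) {O : Set W}
    (hO : IsOpen[zariski W] O) : IsOpen[zariski V] (Ψ ⁻¹' O) := by
  let := zariski V
  refine continuous_def.1 (continuous_generateFrom_iff.2 ?_) O hO
  rintro _ ⟨p, hp, rfl⟩
  exact isOpen_ne_zero (hΨ.comp_mem hp)

end IsPolynomialMap

lemma isOpen_inter_zariski {O O' : Set V} (hO : IsOpen[zariski V] O) (hO' : IsOpen[zariski V] O') :
    IsOpen[zariski V] (O ∩ O') :=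
  @IsOpen.inter V (zariski V) _ _ hO hO'

lemma isOpen_prod_zariski {O : Set V} {O' : Set W} (hO : IsOpen[zariski V] O)
    (hO' : IsOpen[zariski W] O') : IsOpen[zariski (V × W)] (O ×ˢ O') :=
  isOpen_inter_zariski ((isPolynomialMap_linearMap (.fst ℂ V W)).isOpen_preimage hO)
    ((isPolynomialMap_linearMap (.snd ℂ V W)).isOpen_preimage hO')

namespace BinaryForms

variable {n k : ℕ}

lemma coeffMatrix_injective : Function.Injective (coeffMatrix (n := n) (k := k)) := fun f g h =>
  ext_value fun t => by rw [value_eq_mulVec, value_eq_mulVec, h]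

instance : FiniteDimensional ℂ (BinaryForms n k) :=
  Module.Finite.of_injective coeffMatrix coeffMatrix_injective

lemma isPolynomialMap_of_value {Ψ : V → BinaryForms n k}
    (h : ∀ t i, (fun v => (Ψ v).value t i) ∈ polyFunctions V) : IsPolynomialMap Ψ := by
  let φ (ti : (Fin 2 → ℂ) × Fin n) : Module.Dual ℂ (BinaryForms n k) :=
    (MvPolynomial.aeval ti.1).toLinearMap ∘ₗ Submodule.subtype _ ∘ₗ LinearMap.proj ti.2
  exact isPolynomialMap_of_separating (φ := φ) (fun f hf => ext_value fun t => funext fun i =>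
    (hf (t, i)).trans (map_zero (MvPolynomial.eval t)).symm) fun ti => h ti.1 ti.2

lemma isOpen_det_coeffMatrix_ne_zero (k : ℕ) :
    IsOpen[zariski (BinaryForms (k + 1) k)] {g | (coeffMatrix g).det ≠ 0} :=
  isOpen_ne_zero <| det_mem_polyFunctions fun i j =>
    dual_mem_polyFunctions (LinearMap.proj j ∘ₗ LinearMap.proj i ∘ₗ coeffMatrix)

lemma isOpen_resultant_ne_zero (k : ℕ) :
    IsOpen[zariski (BinaryForms 2 k)] {f | f.resultant ≠ 0} := by
  have hcoeff (i : Fin 2) (m : ℕ) :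
      (fun f => (dehomogenize f i).coeff m) ∈ polyFunctions (BinaryForms 2 k) :=
    dual_mem_polyFunctions (Polynomial.lcoeff ℂ m ∘ₗ LinearMap.proj i ∘ₗ dehomogenize)
  refine isOpen_ne_zero <| det_mem_polyFunctions fun i j => ?_
  refine Fin.addCases (fun j => ?_) (fun j => ?_) j <;>
  · simp only [Polynomial.sylvester, Matrix.of_apply, Fin.addCases_left, Fin.addCases_right]
    split_ifs
    exacts [hcoeff _ _, zero_mem _]

end BinaryForms

lemma entry_mem_polyFunctions {m n : ℕ} {e : Fin n → ℤ × ℤ} {d : Fin m → ℤ × ℤ}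
    (φ : Cox →ₗ[ℂ] ℂ) (i : Fin m) (j : Fin n) :
    (fun M : FormMatrix e d => φ (M i j)) ∈ polyFunctions (FormMatrix e d) :=
  dual_mem_polyFunctions (V := FormMatrix e d)
    (φ ∘ₗ Submodule.subtype _ ∘ₗ LinearMap.proj (φ := fun j => Forms (d i - e j)) j ∘ₗ
      LinearMap.proj i)

lemma value_planeForms_mem_polyFunctions (t : Fin 2 → ℂ) (k : Fin 3) :
    (fun M => (planeForms M).value t k) ∈ polyFunctions (FormMatrix syzDeg genDeg) := by
  have hrow i k : (fun M => MvPolynomial.eval t (rowForm M i k)) ∈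
      polyFunctions (FormMatrix syzDeg genDeg) := by
    simp only [rowForm, map_sum, MvPolynomial.smul_eval, MvPolynomial.eval_X]
    exact sum_mem_polyFunctions fun j _ => (polyFunctions _).mul_mem
      (entry_mem_polyFunctions (evalAt 0 (Pi.single k 1)).toLinearMap i.succ j)
      ((polyFunctions _).algebraMap_mem (t j))
  have hmul a b := (polyFunctions _).mul_mem (hrow 0 a) (hrow 1 b)
  simp only [value_planeForms, cross_apply]
  fin_cases k
  exacts [sub_mem (hmul 1 2) (hmul 2 1), sub_mem (hmul 2 0) (hmul 0 2),
    sub_mem (hmul 0 1) (hmul 1 0)]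

lemma eval_lineForm_mem_polyFunctions (v t : Fin 2 → ℂ) :
    (fun M => MvPolynomial.eval t (lineForm M v)) ∈ polyFunctions (FormMatrix syzDeg genDeg) := by
  simp only [eval_lineForm]
  refine sum_mem_polyFunctions fun j _ => (polyFunctions _).mul_mem ?_
    ((polyFunctions _).algebraMap_mem (t j))
  refine eval_mem_polyFunctions (n := 3) (F := fun M => (M 0 j : Cox))
    (x := fun M => Sum.elim v ((planeForms M).value t))
    (fun μ => entry_mem_polyFunctions (MvPolynomial.lcoeff ℂ μ) 0 j)
    (fun M => Nat.cast_le.1 (totalDegree_le_of_mem (top_mem (M := M) j))) ?_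
  rintro (i | k)
  exacts [(polyFunctions _).algebraMap_mem (v i), value_planeForms_mem_polyFunctions t k]

lemma isPolynomialMap_curveForms : IsPolynomialMap curveForms := by
  refine .prodMk (isPolynomialMap_of_value fun t i => ?_)
    (isPolynomialMap_of_value value_planeForms_mem_polyFunctions)
  simp only [value_lineForms]
  fin_cases i
  exacts [neg_mem (eval_lineForm_mem_polyFunctions ![0, 1] t),
    eval_lineForm_mem_polyFunctions ![1, 0] t]

end polyFunctions

/-! ### Every curve with a smooth conic is the curve of a matrix -/

section surjective

open Matrix BinaryForms

lemma transpose_apply_eq_smul_cross_inv {R : Type*} [CommRing R] {A : Matrix (Fin 3) (Fin 3) R}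
    (hA : IsUnit A.det) (k : Fin 3) : Aᵀ k = A.det • (A⁻¹ (k + 1) ⨯₃ A⁻¹ (k + 2)) := by
  have h : A = A.det • adjugate A⁻¹ := by
    calc A = (A.det • A⁻¹.det • 1) * A := by
          rw [smul_smul, mul_comm A.det, det_nonsing_inv_mul_det A hA, one_smul, one_mul]
      _ = A.det • adjugate A⁻¹ := by
          rw [← adjugate_mul, smul_mul_assoc, Matrix.mul_assoc, nonsing_inv_mul A hA, mul_one]
  ext i
  conv_lhs => rw [transpose_apply, h, Matrix.smul_apply, adjugate_fin_three]
  rw [Pi.smul_apply, cross_apply]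
  fin_cases k <;> fin_cases i <;> simp <;> ring

/-- The linear form on the plane with the given coefficients. -/
def planeLinear (y : Fin 3 → ℂ) : Cox := ∑ k, y k • MvPolynomial.X (.inr k)

lemma planeLinear_mem (y : Fin 3 → ℂ) : planeLinear y ∈ Forms (0, 1) :=
  Submodule.sum_mem _ fun k _ => Submodule.smul_mem _ _
    (MvPolynomial.isWeightedHomogeneous_X ℂ bideg (.inr k))

lemma evalAt_planeLinear (s : Fin 2 → ℂ) (x y : Fin 3 → ℂ) :
    evalAt s x (planeLinear y) = y ⬝ᵥ x := by
  simp [planeLinear, dotProduct]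

lemma eval_rowForm_of_eq_planeLinear {M : FormMatrix syzDeg genDeg} {L : Fin 2 → Fin 2 → Fin 3 → ℂ}
    (hL : ∀ i j, (M i.succ j : Cox) = planeLinear (L i j)) (t : Fin 2 → ℂ) (i : Fin 2) :
    (fun k => MvPolynomial.eval t (rowForm M i k)) = ∑ j, t j • L i j := by
  ext k
  simp [rowForm, hL, evalAt_planeLinear, mul_comm]

section conic

variable {g : BinaryForms 3 2} (hg : (coeffMatrix g).det ≠ 0)

include hg

lemma inv_coeffMatrix_dotProduct_value (t : Fin 2 → ℂ) (k : Fin 3) :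
    (coeffMatrix g)⁻¹ k ⬝ᵥ g.value t = t 0 ^ (k : ℕ) * t 1 ^ (2 - k : ℕ) := by
  have h := mulVec_mulVec (fun j : Fin 3 => t 0 ^ (j : ℕ) * t 1 ^ (2 - j : ℕ)) (coeffMatrix g)⁻¹
    (coeffMatrix g)
  rw [← value_eq_mulVec, nonsing_inv_mul _ hg.isUnit, one_mulVec] at h
  exact congrFun h k

lemma exists_planeForms_eq : ∃ L : Fin 2 → Fin 2 → Fin 3 → ℂ, ∀ M : FormMatrix syzDeg genDeg,
    (∀ i j, (M i.succ j : Cox) = planeLinear (L i j)) → planeForms M = g := by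
  let H := (coeffMatrix g)⁻¹
  let Δ := (coeffMatrix g).det
  refine ⟨![![Δ • H 0, -(Δ • H 1)], ![H 1, -H 2]], fun M hM => ext_value fun t => ?_⟩
  have hcross k : (coeffMatrix g)ᵀ k = Δ • (H (k + 1) ⨯₃ H (k + 2)) :=
    transpose_apply_eq_smul_cross_inv hg.isUnit k
  rw [value_planeForms, eval_rowForm_of_eq_planeLinear hM, eval_rowForm_of_eq_planeLinear hM,
    value_eq_mulVec, mulVec_eq_sum, Fin.sum_univ_three, op_smul_eq_smul, op_smul_eq_smul,
    op_smul_eq_smul, hcross, hcross, hcross]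
  have hanti : H 2 ⨯₃ H 0 = -(H 0 ⨯₃ H 2) := (cross_anticomm _ _).symm
  simp only [Fin.sum_univ_two, cons_val', cons_val_fin_one, cons_val_zero, cons_val_one, smul_neg,
    map_add, map_smul, map_neg, LinearMap.add_apply, LinearMap.smul_apply, LinearMap.neg_apply,
    cross_self, Fin.reduceAdd, Fin.coe_ofNat_eq_mod, Nat.reduceAdd, Nat.reduceMod, zero_add, hanti]
  module

lemma exists_quadrics_eq_value {n : ℕ} (f : BinaryForms n 5) (i : Fin n) :
    ∃ Q : Fin 2 → Cox, (∀ j, Q j ∈ Forms (0, 2)) ∧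
      ∀ s t, ∑ j, evalAt s (g.value t) (Q j) * t j = f.value t i := by
  let Y (k : Fin 3) : Cox := planeLinear ((coeffMatrix g)⁻¹ k)
  have hY s t k : evalAt s (g.value t) (Y k) = t 0 ^ (k : ℕ) * t 1 ^ (2 - k : ℕ) := by
    rw [evalAt_planeLinear, inv_coeffMatrix_dotProduct_value hg]
  have hYY (a : ℂ) (k l : Fin 3) : a • (Y k * Y l) ∈ Forms (0, 2) :=
    Submodule.smul_mem _ a (mul_mem (planeLinear_mem _) (planeLinear_mem _))
  let c := coeffMatrix f i
  refine ⟨![c 5 • (Y 2 * Y 2), c 0 • (Y 0 * Y 0) + c 1 • (Y 0 * Y 1) + c 2 • (Y 1 * Y 1) +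
    c 3 • (Y 1 * Y 2) + c 4 • (Y 2 * Y 2)], Fin.forall_fin_two.2 ⟨hYY _ _ _, ?_⟩, fun s t => ?_⟩
  · exact add_mem (add_mem (add_mem (add_mem (hYY _ _ _) (hYY _ _ _)) (hYY _ _ _)) (hYY _ _ _))
      (hYY _ _ _)
  · have hf : f.value t i = ∑ j, coeffMatrix f i j * (t 0 ^ (j : ℕ) * t 1 ^ (5 - j : ℕ)) :=
      congrFun (value_eq_mulVec f t) i
    simp [hf, Fin.sum_univ_succ, hY, c]
    ring

end conic

theorem exists_curveForms_eq {v : BinaryForms 2 5 × BinaryForms 3 2}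
    (hv : (coeffMatrix v.2).det ≠ 0) : ∃ M, curveForms M = v := by
  obtain ⟨f, g⟩ := v
  obtain ⟨L, hL⟩ := exists_planeForms_eq hv
  choose Q hQ hQf using exists_quadrics_eq_value hv f
  let E : Fin 3 → Fin 2 → Cox := Fin.cons
    (fun j => MvPolynomial.X (.inl 0) * Q 1 j - MvPolynomial.X (.inl 1) * Q 0 j)
    fun i j => planeLinear (L i j)
  have hE i j : E i j ∈ Forms (genDeg i - syzDeg j) := by
    have htop : E 0 j ∈ Forms (1, 2) := sub_mem
      (mul_mem (MvPolynomial.isWeightedHomogeneous_X ℂ bideg (.inl 0)) (hQ 1 j))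
      (mul_mem (MvPolynomial.isWeightedHomogeneous_X ℂ bideg (.inl 1)) (hQ 0 j))
    have hlin i : E (Fin.succ i) j ∈ Forms (0, 1) := planeLinear_mem _
    fin_cases i <;> fin_cases j
    exacts [htop, htop, hlin 0, hlin 0, hlin 1, hlin 1]
  let M : FormMatrix syzDeg genDeg := fun i j => ⟨E i j, hE i j⟩
  have hg' : planeForms M = g := hL M fun _ _ => rfl
  refine ⟨M, Prod.ext (ext_value fun t => ?_) hg'⟩
  have hM s : ∑ j, evalAt s (g.value t) (M 0 j) * t j =
      s 0 * f.value t 1 - s 1 * f.value t 0 := by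
    simp only [← hQf _ s, M, E, Fin.cons_zero, map_sub, map_mul, evalAt_X_inl, Finset.mul_sum,
      ← Finset.sum_sub_distrib]
    exact Finset.sum_congr rfl fun j _ => by ring
  rw [curveForms, value_lineForms, eval_lineForm, eval_lineForm, hg', hM, hM]
  ext i
  fin_cases i <;> simp

end surjective

section nondegenerate

open BinaryForms

/-- The tuples of forms whose resultant in the first factor is nonzero, so that the map to the line
has no base points, and whose three plane quadrics are linearly independent, so that the image in
the plane is a smooth conic. -/
def nondegenerateForms (a : ℕ) : Set (BinaryForms 2 a × BinaryForms 3 2) :=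
  {f | f.resultant ≠ 0} ×ˢ {g | (coeffMatrix g).det ≠ 0}

variable {a : ℕ}

lemma isOpen_nondegenerateForms : IsOpen[zariski _] (nondegenerateForms a) :=
  isOpen_prod_zariski (isOpen_resultant_ne_zero a) (isOpen_det_coeffMatrix_ne_zero 2)

lemma nonempty_nondegenerateForms : (nondegenerateForms a).Nonempty :=
  Set.Nonempty.prod (exists_resultant_ne_zero a) (exists_det_coeffMatrix_ne_zero 2)

lemma exists_curve_forms_eq (ha : a ≠ 0) {v : BinaryForms 2 a × BinaryForms 3 2}
    (hv : v ∈ nondegenerateForms a) : ∃ c : RationalCurve a 2, c.forms = v :=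
  ⟨⟨v, fun _ => value_ne_zero_of_resultant_ne_zero ha hv.1,
    fun _ => value_ne_zero_of_det_coeffMatrix_ne_zero hv.2⟩, rfl⟩

end nondegenerate

end ProjLinePlane

end

/-- The first part: every curve in a nonempty (hence dense) Zariski open subset of the irreducible
space of rational curves of bidegree `(5, 2)` has a resolution of the given form. The second part:
whenever a nonempty open set `U` of curves is given, every matrix in a suitable nonempty (hence
dense) Zariski open subset of the vector space of all matrices of the given form presents the ideal
sheaf of a curve in `U`. -/
theorem lemma4p3 :
    (∃ U : Set (ProjLinePlane.RationalCurve 5 2), IsOpen U ∧ U.Nonempty ∧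
      ∀ c ∈ U, ∃ M : ProjLinePlane.FormMatrix ProjLinePlane.syzDeg ProjLinePlane.genDeg,
        ProjLinePlane.Resolves M c.carrier) ∧
    (∀ U : Set (ProjLinePlane.RationalCurve 5 2), IsOpen U → U.Nonempty →
      ∃ W : Set (ProjLinePlane.FormMatrix ProjLinePlane.syzDeg ProjLinePlane.genDeg),
        IsOpen[ProjLinePlane.zariski
          (ProjLinePlane.FormMatrix ProjLinePlane.syzDeg ProjLinePlane.genDeg)] W ∧
        W.Nonempty ∧
        ∀ M ∈ W, ∃ c ∈ U, ProjLinePlane.Resolves M c.carrier) := by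
  open ProjLinePlane in
  refine ⟨⟨RationalCurve.forms ⁻¹' nondegenerateForms 5, ⟨_, isOpen_nondegenerateForms, rfl⟩, ?_,
    fun c hc => ?_⟩, ?_⟩
  · obtain ⟨v, hv⟩ := nonempty_nondegenerateForms (a := 5)
    obtain ⟨c, rfl⟩ := exists_curve_forms_eq (by norm_num) hv
    exact ⟨c, hv⟩
  · obtain ⟨M, hM⟩ := exists_curveForms_eq hc.2
    rw [Set.mem_preimage, ← hM] at hc
    exact ⟨M, resolves hM.symm hc.2⟩
  · rintro _ ⟨O, hO, rfl⟩ ⟨c₀, hc₀⟩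
    refine ⟨curveForms ⁻¹' (O ∩ nondegenerateForms 5), isPolynomialMap_curveForms.isOpen_preimage
      (isOpen_inter_zariski hO isOpen_nondegenerateForms), ?_, fun M ⟨hMO, hM⟩ => ?_⟩
    · obtain ⟨v, hv⟩ := nonempty_inter_of_isOpen_zariski hO isOpen_nondegenerateForms ⟨_, hc₀⟩
        nonempty_nondegenerateForms
      obtain ⟨M, rfl⟩ := exists_curveForms_eq hv.2.2
      exact ⟨M, hv⟩
    · obtain ⟨c, hc⟩ := exists_curve_forms_eq (by norm_num) hM
      exact ⟨c, Set.mem_preimage.2 (hc ▸ hMO), resolves hc hM.2⟩
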